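/- Setting. Let $X=(x_1,\dots,x_p)\in\mathbb R^{n\times p}$, $y\in\mathbb R^n$, $\beta^*\in\mathbb R^p$, $\lambda_0>0$, $\xi>1$. Put $\operatorname{supp}(\beta)=\{j:\beta_j\ne0\}$, $S=\operatorname{supp}(\beta^*)$, $\sigma^*=|y-X\beta^*|_2/\sqrt n$, assumed positive, and $z^*=|X'(y-X\beta^*)/n|_\infty/\sigma^*$. A minimum over an empty set is $\infty$, and $a/0=\infty$ for $a>0$, $a/\infty=0$. For $T\subseteq\{1,\dots,p\}$ let $$\kappa(\xi,T)=\min\Big\{\frac{|T|^{1/2}|Xu|_2}{n^{1/2}|u_T|_1}:\ |u_{T^c}|_1\le\xi|u_T|_1,\ u\ne0\Big\},$$ $$\eta(\lambda,\xi,w,T)=\frac{|X\beta^*-Xw|_2^2}{n}+(1+\delta_{w,T})2\lambda|w_{T^c}|_1+\frac{4\xi^2\lambda^2|T|}{(\xi+1)^2\kappa^2(\xi,T)},\qquad \eta_*(\lambda,\xi)=\inf_{w,T}\eta(\lambda,\xi,w,T),$$ where $\delta_{w,T}=0$ if $w=\beta^*$ and $T=\emptyset$, and $\delta_{w,T}=1$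 otherwise; $$\mu(\lambda,\xi)=(\xi+1)\min_T\inf_{0<\nu<1}\max\Big[\frac{|\beta^*_{T^c}|_1}{\nu},\ \frac{\lambda|T|/\{2(1-\nu)\}}{\kappa^2\{(\xi+\nu)/(1-\nu),T\}}\Big],\qquad \tau_*=\{\lambda_0\mu(\sigma^*\lambda_0,\xi)/\sigma^*\}^{1/2}.$$ With $X_B$ the matrix of the columns with indices in $B$, let $$\kappa_-(m,T)=\min_{B\supseteq T,\ |B\setminus T|\le m}\lambda_{\min}(X_B'X_B/n),\qquad \kappa_+(m,T)=\max_{B\cap T=\emptyset,\ |B|\le m}\lambda_{\max}(X_B'X_B/n)$$ (for $B=\emptyset$ put $\lambda_{\min}=\infty$, $\lambda_{\max}=0$). Let $P_B$ be the orthogonal projection onto the span of $\{x_j:j\in B\}$, and $$\sigma^*_{m,S}=\max_{B\supseteq S,\ |B\setminus S|=m}|P_B(y-X\beta^*)|_2/\sqrt n$$ (if $m>p-|S|$, take $B=\{1,\dots,p\}$). Let $(\hat\beta,\hat\sigma)$ be any scaled lasso estimator, i.e. a minimizer of $|y-X\beta|_2^2/(2n\sigma)+\sigma/2+\lambda_0|\beta|_1$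 over $\beta\in\mathbb R^p$, $\sigma>0$. Put $\hat S=\operatorname{supp}(\hat\beta)$ and $\hat\lambda=\hat\sigma\lambda_0$. Let $\bar\beta$ be any minimizer of $|y-X\beta|_2^2$ over $\{\beta:\operatorname{supp}(\beta)\subseteq\hat S\}$, and $\bar\sigma=|y-X\bar\beta|_2/\sqrt n$. Theorem 3. (i) Let $m$ be an integer with $|S|\xi^2/\kappa^2(\xi,S)<m/\kappa_+(m,S)$. If $z^*\le(1-\tau_*^2)\lambda_0(\xi-1)/(\xi+1)$, then $$|\hat S\setminus S|<m,\qquad \hat\sigma^2-\{\sigma^*_{m-1,S}+\sqrt{\eta_*(\hat\lambda,\xi)}\}^2\le\bar\sigma^2\le\hat\sigma^2,$$ with $(1-\tau_*^2)\hat\lambda\le\sigma^*\lambda_0$, and $$\kappa_-(m-1,S)|\bar\beta-\beta^*|_2^2\le|X\bar\beta-X\beta^*|_2^2/n\le\{\sigma^*_{m-1,S}+2\sqrt{\eta_*(\hat\lambda,\xi)}\}^2.$$ (ii) Let $\mathrm{pr}_{\beta^*,\sigma}$, $\sigma>0$, be the law of $y$ under which $y-X\beta^*\sim N(0,\sigma^2I_n)$.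 For all integers $1\le m\le p$ and all $\epsilon>0$, $$\mathrm{pr}_{\beta^*,\sigma}\Big[\sigma^*_{m,S}\sqrt n/\sigma\ge\sqrt{m+|S|}+\sqrt{2m\log(ep/m)+2\log(1/\epsilon)}\Big]\le\frac{\epsilon/m}{\sqrt{2\pi}}$$ (a square root of a negative number is read as $0$; the right-hand side then exceeds $1$). (iii) In addition, suppose $|x_j|_2^2=n$ for all $j$. As $n-2>\log(p/\epsilon)\to\infty$, uniformly in all other quantities, with $\mathrm{pr}_{\beta^*,\sigma}$-probability at least $1-\{1+o(1)\}\epsilon/\{\pi\log(p/\epsilon)\}^{1/2}$ the following holds: if $\tau_*<1$ and $\lambda_0\ge\{(2/n)\log(p/\epsilon)\}^{1/2}(\xi+1)/\{(\xi-1)(1-\tau_*^2)\}$, then $z^*\le(1-\tau_*^2)\lambda_0(\xi-1)/(\xi+1)$. -/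

import Mathlib

open MeasureTheory ProbabilityTheory
open scoped ENNReal

noncomputable section

namespace ScaledLasso

variable {n p : ℕ}

/-- The fitted vector `X β ∈ ℝⁿ`. -/
def fit (X : Matrix (Fin n) (Fin p) ℝ) (b : EuclideanSpace ℝ (Fin p)) :
    EuclideanSpace ℝ (Fin n) :=
  WithLp.toLp 2 (X.mulVec b.ofLp)

/-- The `j`-th column `x_j` of the design matrix. -/
def col (X : Matrix (Fin n) (Fin p) ℝ) (j : Fin p) : EuclideanSpace ℝ (Fin n) :=
  WithLp.toLp 2 (fun i => X i j)

/-- `|u_T|₁ = ∑_{j ∈ T} |u_j|`. -/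
def l1On (T : Finset (Fin p)) (u : EuclideanSpace ℝ (Fin p)) : ℝ := ∑ j ∈ T, |u j|

/-- `supp u = {j : u_j ≠ 0}`. -/
def supp (u : EuclideanSpace ℝ (Fin p)) : Finset (Fin p) := {j | u j ≠ 0}

/-! ### The estimators -/

/-- The penalized joint loss `|y - Xβ|₂² / (2 n σ) + σ / 2 + λ₀ |β|₁` (used for `σ > 0`). -/
def jointLoss (X : Matrix (Fin n) (Fin p) ℝ) (y : EuclideanSpace ℝ (Fin n)) (lam0 : ℝ)
    (b : EuclideanSpace ℝ (Fin p)) (s : ℝ) : ℝ :=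
  ‖y - fit X b‖ ^ 2 / (2 * n * s) + s / 2 + lam0 * l1On Finset.univ b

/-- `(b, s)` is a scaled lasso estimator: a joint minimizer of the loss over
`β ∈ ℝᵖ` and `σ > 0`. -/
def IsScaledLasso (X : Matrix (Fin n) (Fin p) ℝ) (y : EuclideanSpace ℝ (Fin n)) (lam0 : ℝ)
    (b : EuclideanSpace ℝ (Fin p)) (s : ℝ) : Prop :=
  0 < s ∧ ∀ (b' : EuclideanSpace ℝ (Fin p)) (s' : ℝ), 0 < s' →
    jointLoss X y lam0 b s ≤ jointLoss X y lam0 b' s'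

/-- `b` minimizes `|y - Xβ|₂²` over all `β` supported in the support of `bhat`. -/
def IsRefit (X : Matrix (Fin n) (Fin p) ℝ) (y : EuclideanSpace ℝ (Fin n))
    (bhat b : EuclideanSpace ℝ (Fin p)) : Prop :=
  supp b ⊆ supp bhat ∧ ∀ b' : EuclideanSpace ℝ (Fin p), supp b' ⊆ supp bhat →
    ‖y - fit X b‖ ^ 2 ≤ ‖y - fit X b'‖ ^ 2

/-- The root mean square residual `|y - Xβ|₂ / √n`. At `β = β*` this is the oracle noise
level `σ*`; at the refitted least squares estimator it is the refit noise estimate. -/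
def residualLevel (X : Matrix (Fin n) (Fin p) ℝ) (y : EuclideanSpace ℝ (Fin n))
    (b : EuclideanSpace ℝ (Fin p)) : ℝ :=
  ‖y - fit X b‖ / √(n : ℝ)

/-- `z* = |X'(y - Xβ*) / n|_∞ / σ*`. -/
def zStar (X : Matrix (Fin n) (Fin p) ℝ) (y : EuclideanSpace ℝ (Fin n))
    (bs : EuclideanSpace ℝ (Fin p)) : ℝ :=
  (⨆ j : Fin p, |inner ℝ (col X j) (y - fit X bs) / n|) / residualLevel X y bs

/-! ### Compatibility factor and error bounds

These are computed in `[0, ∞]`, so that a minimum over an empty set is `∞`, and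
`a / 0 = ∞` for `a > 0`, `a / ∞ = 0`. -/

/-- The compatibility factor
`κ(ξ, T) = min { |T|^{1/2} |Xu|₂ / (n^{1/2} |u_T|₁) : |u_{Tᶜ}|₁ ≤ ξ |u_T|₁, u ≠ 0 }`. -/
def kappa (X : Matrix (Fin n) (Fin p) ℝ) (xi : ℝ) (T : Finset (Fin p)) : ℝ≥0∞ :=
  ⨅ u : EuclideanSpace ℝ (Fin p), ⨅ _ : l1On Tᶜ u ≤ xi * l1On T u ∧ u ≠ 0,
    ENNReal.ofReal (√(T.card : ℝ) * ‖fit X u‖ / (√(n : ℝ) * l1On T u))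

open Classical in
/-- The prediction error bound `η(λ, ξ, w, T)`. -/
def eta (X : Matrix (Fin n) (Fin p) ℝ) (bs : EuclideanSpace ℝ (Fin p)) (lam xi : ℝ)
    (w : EuclideanSpace ℝ (Fin p)) (T : Finset (Fin p)) : ℝ≥0∞ :=
  ENNReal.ofReal (‖fit X bs - fit X w‖ ^ 2 / n
      + (1 + (if w = bs ∧ T = ∅ then 0 else 1)) * 2 * lam * l1On Tᶜ w)
    + ENNReal.ofReal (4 * xi ^ 2 * lam ^ 2 * T.card / (xi + 1) ^ 2) / kappa X xi T ^ 2

/-- `inf_{w,T} η(λ, ξ, w, T)` in `[0, ∞]`. -/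
def etaInf (X : Matrix (Fin n) (Fin p) ℝ) (bs : EuclideanSpace ℝ (Fin p)) (lam xi : ℝ) :
    ℝ≥0∞ :=
  ⨅ (w : EuclideanSpace ℝ (Fin p)) (T : Finset (Fin p)), eta X bs lam xi w T

/-- `η_*(λ, ξ) = inf_{w,T} η(λ, ξ, w, T)` as a real number; the infimum is always finite
(`etaInf_ne_top`). -/
def etaStar (X : Matrix (Fin n) (Fin p) ℝ) (bs : EuclideanSpace ℝ (Fin p)) (lam xi : ℝ) : ℝ :=
  (etaInf X bs lam xi).toReal

/-- The `ℓ₁` error bound `μ(λ, ξ)` in `[0, ∞]`. -/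
def muInf (X : Matrix (Fin n) (Fin p) ℝ) (bs : EuclideanSpace ℝ (Fin p)) (lam xi : ℝ) :
    ℝ≥0∞ :=
  ENNReal.ofReal (xi + 1) * ⨅ (T : Finset (Fin p)) (nu : ℝ) (_ : 0 < nu ∧ nu < 1),
    max (ENNReal.ofReal (l1On Tᶜ bs / nu))
      (ENNReal.ofReal (lam * T.card / (2 * (1 - nu)))
        / kappa X ((xi + nu) / (1 - nu)) T ^ 2)

/-- The `ℓ₁` error bound
`μ(λ, ξ) = (ξ+1) min_T inf_{0<ν<1}
  max { |β*_{Tᶜ}|₁ / ν, (λ|T| / {2(1-ν)}) / κ²((ξ+ν)/(1-ν), T) }`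
as a real number; it is always finite (`muInf_ne_top`). -/
def mu (X : Matrix (Fin n) (Fin p) ℝ) (bs : EuclideanSpace ℝ (Fin p)) (lam xi : ℝ) : ℝ :=
  (muInf X bs lam xi).toReal

theorem etaInf_ne_top (X : Matrix (Fin n) (Fin p) ℝ) (bs : EuclideanSpace ℝ (Fin p))
    (lam xi : ℝ) : etaInf X bs lam xi ≠ ∞ := by
  refine ne_top_of_le_ne_top (b := eta X bs lam xi bs ∅) ?_ (iInf₂_le _ _)
  simp [eta]

theorem muInf_ne_top (X : Matrix (Fin n) (Fin p) ℝ) (bs : EuclideanSpace ℝ (Fin p))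
    (lam xi : ℝ) : muInf X bs lam xi ≠ ∞ := by
  refine ENNReal.mul_ne_top ENNReal.ofReal_ne_top ?_
  refine ne_top_of_le_ne_top ?_
    ((iInf_le _ (∅ : Finset (Fin p))).trans
      ((iInf_le _ (1 / 2 : ℝ)).trans (iInf_le _ (by norm_num))))
  simp

/-- `τ_* = {λ₀ μ(σ* λ₀, ξ) / σ*}^{1/2}`. -/
def tauStar (X : Matrix (Fin n) (Fin p) ℝ) (y : EuclideanSpace ℝ (Fin n))
    (bs : EuclideanSpace ℝ (Fin p)) (lam0 xi : ℝ) : ℝ :=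
  √(lam0 * mu X bs (residualLevel X y bs * lam0) xi / residualLevel X y bs)

/-! ### Sparse eigenvalues -/

/-- `X_B' X_B / n`, with `X_B` the columns of `X` with indices in `B`. -/
def gram (X : Matrix (Fin n) (Fin p) ℝ) (B : Finset (Fin p)) : Matrix B B ℝ :=
  (n : ℝ)⁻¹ • ((X.submatrix id (Subtype.val : B → Fin p)).transpose
    * X.submatrix id (Subtype.val : B → Fin p))

/-- `κ₋(m, T)`: the minimum, over `B ⊇ T` with `|B \ T| ≤ m`, of the smallest eigenvalue of
`X_B' X_B / n`. Eigenvalues of these matrices are nonnegative; the empty matrix has none and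
contributes `∞`. -/
def kappaMinus (X : Matrix (Fin n) (Fin p) ℝ) (m : ℕ) (T : Finset (Fin p)) : ℝ≥0∞ :=
  ⨅ (B : Finset (Fin p)) (_ : T ⊆ B ∧ (B \ T).card ≤ m)
    (e : ℝ) (_ : Module.End.HasEigenvalue (Matrix.toLin' (gram X B)) e), ENNReal.ofReal e

/-- `κ₊(m, T)`: the maximum, over `B` disjoint from `T` with `|B| ≤ m`, of the largest eigenvalue
of `X_B' X_B / n`; the empty matrix contributes `0`. -/
def kappaPlus (X : Matrix (Fin n) (Fin p) ℝ) (m : ℕ) (T : Finset (Fin p)) : ℝ≥0∞ :=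
  ⨆ (B : Finset (Fin p)) (_ : Disjoint B T ∧ B.card ≤ m)
    (e : ℝ) (_ : Module.End.HasEigenvalue (Matrix.toLin' (gram X B)) e), ENNReal.ofReal e

/-! ### Projected noise and the Gaussian model -/

/-- The orthogonal projection `P_B v` of `v` onto the linear span of `x_j`, `j ∈ B`. -/
def proj (X : Matrix (Fin n) (Fin p) ℝ) (B : Finset (Fin p)) (v : EuclideanSpace ℝ (Fin n)) :
    EuclideanSpace ℝ (Fin n) :=
  (Submodule.span ℝ (col X '' (B : Set (Fin p)))).starProjection v

/-- `σ*_{m,S} = max { |P_B (y - Xβ*)|₂ / √n : B ⊇ S, |B \ S| = m }` with `S = supp β*`.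
If fewer than `m` indices lie outside `S`, then `B` is the set of all indices. -/
def sigmaStar (X : Matrix (Fin n) (Fin p) ℝ) (y : EuclideanSpace ℝ (Fin n))
    (bs : EuclideanSpace ℝ (Fin p)) (m : ℕ) : ℝ :=
  ⨆ B : {B : Finset (Fin p) //
      supp bs ⊆ B ∧ (B \ supp bs).card = min m ((supp bs)ᶜ).card},
    ‖proj X B.1 (y - fit X bs)‖ / √(n : ℝ)

/-- `pr_{β,σ}`: the law of `y` under which `y - Xβ ~ N(0, σ² I_n)`. -/
def pr (X : Matrix (Fin n) (Fin p) ℝ) (b : EuclideanSpace ℝ (Fin p)) (s : ℝ) :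
    Measure (EuclideanSpace ℝ (Fin n)) :=
  (stdGaussian (EuclideanSpace ℝ (Fin n))).map (fun g => fit X b + s • g)

end ScaledLasso

end

open ScaledLasso

namespace ScaledLasso

variable {n p : ℕ}

/-! Write ε = y − Xβ*, s = σ*, a = 1 − τ_*². A scaled lasso solution is an ordinary lasso solution
at penalty σ̂λ₀ whose root mean square residual is exactly σ̂. The deterministic part uses only
these two facts, the first as the variational inequality `LassoCondition`. When the noise level σ*z*
is at most λ(ξ−1)/(ξ+1), `LassoCondition.basic` puts the error in a cone up to the tail of the
target; the compatibility factor and a completed square then bound the ℓ₁ error by μ and the squared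
prediction error by η.

The penalty is random, so these bounds apply to β̂ only once σ̂ ≥ a s is known. Comparing lasso
solutions at two penalties (`LassoCondition.mul_sub_nonpos`) shows that the scaled lasso level
cannot lie below a s if the lasso at penalty a s λ₀ leaves a residual level above a s. It does,
because μ controls how far the residual of a lasso solution can be from ε. The upper bound a σ̂ ≤ s
compares β̂ with β* directly.

A falsely selected column has correlation nλ̂ with the lasso residual but at most n σ*z* with ε, so
it correlates with X(β̂ − β*) by at least 2nλ̂/(ξ+1). Summing m such squares against κ₊ contradicts
the prediction bound. The refit is the projection of y on the selected columns, and Pythagoras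
together with the projected noise σ*_{m−1,S} gives the remaining bounds.

For the Gaussian tail, each projected noise vector is standard Gaussian in dimension at most m +
|S|. A Chernoff bound with the optimal exponent keeps a second exponential factor, and in the union
over the sets B this factor supplies the 1/√m that Stirling's formula leaves missing.

For the last part, z* is the largest absolute cosine between ε and a column, so its tail is a union
of p double cones (spherical caps). `stdGaussian_cone_le` bounds one of them by integrating the
one-dimensional Gaussian tail over the norm of the orthogonal component. -/

/-! ### Linearity of the fitted vector. -/

lemma fit_eq_sum (X : Matrix (Fin n) (Fin p) ℝ) (b : EuclideanSpace ℝ (Fin p)) :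
    fit X b = ∑ j, b j • col X j := by
  ext i
  simp [fit, col, Matrix.mulVec, dotProduct, mul_comm]

lemma fit_add (X : Matrix (Fin n) (Fin p) ℝ) (a b : EuclideanSpace ℝ (Fin p)) :
    fit X (a + b) = fit X a + fit X b := by
  simp [fit_eq_sum, add_smul, Finset.sum_add_distrib]

lemma fit_smul (X : Matrix (Fin n) (Fin p) ℝ) (c : ℝ) (b : EuclideanSpace ℝ (Fin p)) :
    fit X (c • b) = c • fit X b := by
  simp [fit_eq_sum, mul_smul, Finset.smul_sum]

lemma fit_sub (X : Matrix (Fin n) (Fin p) ℝ) (a b : EuclideanSpace ℝ (Fin p)) :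
    fit X (a - b) = fit X a - fit X b := by
  simp [fit_eq_sum, sub_smul, Finset.sum_sub_distrib]

lemma fit_zero (X : Matrix (Fin n) (Fin p) ℝ) : fit X 0 = 0 := by
  simp [fit_eq_sum]

lemma continuous_fit (X : Matrix (Fin n) (Fin p) ℝ) : Continuous (fit X) := by
  rw [show fit X = fun b => ∑ j, b j • col X j from funext (fit_eq_sum X)]
  fun_prop

lemma inner_fit (X : Matrix (Fin n) (Fin p) ℝ) (v : EuclideanSpace ℝ (Fin n))
    (u : EuclideanSpace ℝ (Fin p)) :
    inner ℝ v (fit X u) = ∑ j, u j * inner ℝ (col X j) v := by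
  rw [fit_eq_sum, inner_sum]
  exact Finset.sum_congr rfl fun j _ => by rw [inner_smul_right, real_inner_comm]

/-! ### Partial `ℓ₁` norms -/

lemma l1On_nonneg (T : Finset (Fin p)) (u : EuclideanSpace ℝ (Fin p)) : 0 ≤ l1On T u :=
  Finset.sum_nonneg fun _ _ => abs_nonneg _

lemma l1On_univ (T : Finset (Fin p)) (u : EuclideanSpace ℝ (Fin p)) :
    l1On Finset.univ u = l1On T u + l1On Tᶜ u :=
  (Finset.sum_add_sum_compl T _).symm

lemma l1On_smul (T : Finset (Fin p)) (c : ℝ) (u : EuclideanSpace ℝ (Fin p)) :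
    l1On T (c • u) = |c| * l1On T u := by
  simp [l1On, abs_mul, Finset.mul_sum]

lemma l1On_add_le (T : Finset (Fin p)) (u v : EuclideanSpace ℝ (Fin p)) :
    l1On T (u + v) ≤ l1On T u + l1On T v := by
  rw [l1On, l1On, l1On, ← Finset.sum_add_distrib]
  exact Finset.sum_le_sum fun j _ => abs_add_le _ _

lemma l1On_neg (T : Finset (Fin p)) (u : EuclideanSpace ℝ (Fin p)) :
    l1On T (-u) = l1On T u := by
  simp [l1On]

lemma l1On_le_add_sub (T : Finset (Fin p)) (u v : EuclideanSpace ℝ (Fin p)) :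
    l1On T u ≤ l1On T v + l1On T (u - v) := by
  simpa using l1On_add_le T v (u - v)

lemma l1On_sub_comm (T : Finset (Fin p)) (u v : EuclideanSpace ℝ (Fin p)) :
    l1On T (u - v) = l1On T (v - u) := by
  rw [← l1On_neg, neg_sub]

lemma l1On_sub_le (T : Finset (Fin p)) (u v : EuclideanSpace ℝ (Fin p)) :
    l1On T (u - v) ≤ l1On T u + l1On T v := by
  simpa [sub_eq_add_neg, l1On_neg] using l1On_add_le T u (-v)

lemma l1On_zero (T : Finset (Fin p)) : l1On T (0 : EuclideanSpace ℝ (Fin p)) = 0 := by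
  simp [l1On]

lemma eq_zero_of_l1On_univ {u : EuclideanSpace ℝ (Fin p)} (h : l1On Finset.univ u = 0) :
    u = 0 := by
  rw [l1On, Finset.sum_eq_zero_iff_of_nonneg (fun _ _ => abs_nonneg _)] at h
  ext j
  simpa using h j (Finset.mem_univ j)

lemma l1On_compl_supp (u : EuclideanSpace ℝ (Fin p)) : l1On (supp u)ᶜ u = 0 := by
  refine Finset.sum_eq_zero fun j hj => ?_
  simpa [supp] using hj

lemma norm_le_l1On_univ (u : EuclideanSpace ℝ (Fin p)) : ‖u‖ ≤ l1On Finset.univ u := by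
  have h : u = ∑ j, EuclideanSpace.single j (u j) := by
    ext i
    simp [Finset.sum_apply, Pi.single_apply]
  calc ‖u‖ = ‖∑ j, EuclideanSpace.single j (u j)‖ := by rw [← h]
    _ ≤ ∑ j, ‖EuclideanSpace.single j (u j)‖ := norm_sum_le _ _
    _ = l1On Finset.univ u := by simp [l1On]

lemma continuous_l1On (T : Finset (Fin p)) : Continuous (l1On T) := by
  unfold l1On
  fun_prop

/-! ### The variational inequality of the lasso -/

/-- The first order condition of the lasso with penalty level `lam`. -/
def LassoCondition (X : Matrix (Fin n) (Fin p) ℝ) (y : EuclideanSpace ℝ (Fin n)) (lam : ℝ)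
    (b : EuclideanSpace ℝ (Fin p)) : Prop :=
  ∀ b' : EuclideanSpace ℝ (Fin p), inner ℝ (y - fit X b) (fit X (b' - b))
    ≤ n * lam * (l1On Finset.univ b' - l1On Finset.univ b)

lemma norm_sub_fit_sq (X : Matrix (Fin n) (Fin p) ℝ) (y : EuclideanSpace ℝ (Fin n))
    (b d : EuclideanSpace ℝ (Fin p)) :
    ‖y - fit X (b + d)‖ ^ 2
      = ‖y - fit X b‖ ^ 2 - 2 * inner ℝ (y - fit X b) (fit X d) + ‖fit X d‖ ^ 2 := by
  rw [fit_add, ← sub_sub, norm_sub_sq_real]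

/-- Along the segment from `b` to `b'` the penalty is convex and the quadratic term is of second
order in the step. Dividing by the step and letting it tend to zero leaves the first order
inequality. -/
lemma LassoCondition.of_isMin {X : Matrix (Fin n) (Fin p) ℝ} {y : EuclideanSpace ℝ (Fin n)}
    {lam : ℝ} (hlam : 0 ≤ lam) {b : EuclideanSpace ℝ (Fin p)}
    (h : ∀ b', ‖y - fit X b‖ ^ 2 + 2 * n * lam * l1On Finset.univ b
      ≤ ‖y - fit X b'‖ ^ 2 + 2 * n * lam * l1On Finset.univ b') :
    LassoCondition X y lam b := by
  intro b'
  have key : ∀ s ∈ Set.Ioc (0 : ℝ) 1, inner ℝ (y - fit X b) (fit X (b' - b))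
      ≤ n * lam * (l1On Finset.univ b' - l1On Finset.univ b)
        + s * (‖fit X (b' - b)‖ ^ 2 / 2) := by
    rintro s ⟨hs0, hs1⟩
    have h1 := h (b + s • (b' - b))
    rw [norm_sub_fit_sq, fit_smul, inner_smul_right, norm_smul, Real.norm_of_nonneg hs0.le] at h1
    have h2 : l1On Finset.univ (b + s • (b' - b))
        ≤ (1 - s) * l1On Finset.univ b + s * l1On Finset.univ b' := by
      rw [show b + s • (b' - b) = (1 - s) • b + s • b' by module]
      refine (l1On_add_le _ _ _).trans ?_
      rw [l1On_smul, l1On_smul, abs_of_nonneg hs0.le, abs_of_nonneg (by linarith)]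
    have h3 : 2 * n * lam * l1On Finset.univ (b + s • (b' - b))
        ≤ 2 * n * lam * ((1 - s) * l1On Finset.univ b + s * l1On Finset.univ b') := by gcongr
    have h4 : s * inner ℝ (y - fit X b) (fit X (b' - b))
        ≤ s * (n * lam * (l1On Finset.univ b' - l1On Finset.univ b)
        + s * (‖fit X (b' - b)‖ ^ 2 / 2)) := by nlinarith
    exact le_of_mul_le_mul_left h4 hs0
  have hlim : Filter.Tendsto (fun s : ℝ => n * lam * (l1On Finset.univ b' - l1On Finset.univ b)
        + s * (‖fit X (b' - b)‖ ^ 2 / 2)) (nhdsWithin 0 (Set.Ioi 0))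
        (nhds (n * lam * (l1On Finset.univ b' - l1On Finset.univ b)
        + 0 * (‖fit X (b' - b)‖ ^ 2 / 2))) :=
    (Continuous.tendsto (by fun_prop) 0).mono_left nhdsWithin_le_nhds
  rw [zero_mul, add_zero] at hlim
  refine ge_of_tendsto hlim ?_
  filter_upwards [Ioc_mem_nhdsGT (zero_lt_one' ℝ)] with s hs using key s hs

lemma exists_lassoCondition (X : Matrix (Fin n) (Fin p) ℝ) (y : EuclideanSpace ℝ (Fin n))
    {lam : ℝ} (hlam : 0 < lam) (hn : 0 < n) : ∃ b, LassoCondition X y lam b := by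
  have hc : 0 < 2 * n * lam := by positivity
  obtain ⟨b, hb⟩ := Continuous.exists_forall_le
    (f := fun b => ‖y - fit X b‖ ^ 2 + 2 * n * lam * l1On Finset.univ b)
    (by
      have := continuous_fit X
      have := continuous_l1On (Finset.univ : Finset (Fin p))
      fun_prop)
    (Filter.tendsto_atTop_mono (f := fun b => 2 * n * lam * ‖b‖)
      (fun b => by
        have := mul_le_mul_of_nonneg_left (norm_le_l1On_univ b) hc.le
        have := sq_nonneg ‖y - fit X b‖
        linarith)
      (Filter.Tendsto.const_mul_atTop hc tendsto_norm_cocompact_atTop))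
  exact ⟨b, LassoCondition.of_isMin hlam.le hb⟩

lemma IsScaledLasso.lassoCondition {X : Matrix (Fin n) (Fin p) ℝ}
    {y : EuclideanSpace ℝ (Fin n)} {lam0 s : ℝ} {b : EuclideanSpace ℝ (Fin p)} (hn : 0 < n)
    (hlam : 0 ≤ lam0) (h : IsScaledLasso X y lam0 b s) : LassoCondition X y (s * lam0) b := by
  have hs := h.1
  refine LassoCondition.of_isMin (by positivity) fun b' => ?_
  have h1 := mul_le_mul_of_nonneg_left (h.2 b' s hs) (by positivity : 0 ≤ 2 * n * s)
  have hn' : (0 : ℝ) < n := by exact_mod_cast hn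
  have e : ∀ c, 2 * n * s * jointLoss X y lam0 c s
      = ‖y - fit X c‖ ^ 2 + 2 * n * (s * lam0) * l1On Finset.univ c + n * s ^ 2 := by
    intro c
    rw [jointLoss]
    field_simp
    ring
  rw [e, e] at h1
  linarith

/-- Only the minimization over σ is used: for fixed β, a²/(2σ) + σ/2 is smallest at σ = a. A perfect
fit a = 0 is impossible, since halving σ would lower the loss. -/
lemma IsScaledLasso.norm_sq_eq {X : Matrix (Fin n) (Fin p) ℝ}
    {y : EuclideanSpace ℝ (Fin n)} {lam0 s : ℝ} {b : EuclideanSpace ℝ (Fin p)} (hn : 0 < n)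
    (h : IsScaledLasso X y lam0 b s) : ‖y - fit X b‖ ^ 2 = n * s ^ 2 := by
  have hs := h.1
  have hn' : (0 : ℝ) < n := by exact_mod_cast hn
  set a := ‖y - fit X b‖ / √(n : ℝ) with ha
  have ha0 : 0 ≤ a := by positivity
  have hA : ‖y - fit X b‖ ^ 2 = n * a ^ 2 := by
    rw [ha, div_pow, Real.sq_sqrt hn'.le]
    field_simp
  have key : ∀ t, 0 < t → a ^ 2 / (2 * s) + s / 2 ≤ a ^ 2 / (2 * t) + t / 2 := by
    intro t ht
    have h1 := h.2 b t ht
    rw [jointLoss, jointLoss, hA] at h1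
    have e : ∀ t : ℝ, 0 < t → n * a ^ 2 / (2 * n * t) = a ^ 2 / (2 * t) := by
      intro t ht
      field_simp
    rw [e s hs, e t ht] at h1
    linarith
  rw [hA]
  rcases ha0.eq_or_lt with h0 | h0
  · have := key (s / 2) (by positivity)
    rw [← h0] at this
    norm_num at this
    linarith
  · have h1 := key a h0
    have h2 : a ^ 2 / (2 * a) + a / 2 = a := by
      field_simp
      norm_num
    rw [h2, div_add_div _ _ (by positivity) (by norm_num), div_le_iff₀ (by positivity)] at h1
    have h3 : (a - s) ^ 2 ≤ 0 := by nlinarith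
    have h4 : a - s = 0 := by
      have := sq_nonneg (a - s)
      exact pow_eq_zero_iff (two_ne_zero) |>.1 (le_antisymm h3 this)
    rw [sub_eq_zero.1 h4]

/-- `LassoCondition` solutions at two penalty levels: with `s` the residual level of the solution
at level `t`, `(s - t) (s - s') ≤ 0`. -/
lemma LassoCondition.mul_sub_nonpos {X : Matrix (Fin n) (Fin p) ℝ}
    {y : EuclideanSpace ℝ (Fin n)} {lam0 s s' t : ℝ} {b b' : EuclideanSpace ℝ (Fin p)}
    (hn : 0 < n) (ht : 0 < t) (hs' : 0 < s') (hs : 0 ≤ s)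
    (hb : LassoCondition X y (t * lam0) b) (hb' : LassoCondition X y (s' * lam0) b')
    (hsb : ‖y - fit X b‖ ^ 2 = n * s ^ 2) (hsb' : ‖y - fit X b'‖ ^ 2 = n * s' ^ 2) :
    (s - t) * (s - s') ≤ 0 := by
  have hn' : (0 : ℝ) < n := by exact_mod_cast hn
  set r := y - fit X b with hr
  set r' := y - fit X b' with hr'
  have h1 := hb b'
  have h2 := hb' b
  rw [fit_sub, show fit X b' - fit X b = r - r' by rw [hr, hr']; abel, ← hr, inner_sub_right,
    real_inner_self_eq_norm_sq, hsb] at h1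
  rw [fit_sub, show fit X b - fit X b' = r' - r by rw [hr, hr']; abel, ← hr', inner_sub_right,
    real_inner_self_eq_norm_sq, hsb', real_inner_comm] at h2
  have hc : inner ℝ r r' ≤ n * (s * s') := by
    refine (real_inner_le_norm r r').trans (abs_le_of_sq_le_sq' ?_ (by positivity)).2
    rw [mul_pow, hsb, hsb']
    exact le_of_eq (by ring)
  set c := inner ℝ r r'
  set D := l1On Finset.univ b' - l1On Finset.univ b
  have h2' : n * s' ^ 2 - c ≤ - (n * (s' * lam0) * D) := by linarith
  -- With weights `s'` and `t` the ℓ₁ terms of the two inequalities cancel. Cauchy–Schwarz then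
  -- leaves n s' (s − t)(s − s') ≤ 0.
  have h3 := mul_le_mul_of_nonneg_left h1 hs'.le
  have h4 := mul_le_mul_of_nonneg_left h2' ht.le
  have h5 : s' * (n * s ^ 2) + t * (n * s' ^ 2) ≤ (s' + t) * (n * (s * s')) := by
    have := mul_le_mul_of_nonneg_left hc (by positivity : 0 ≤ s' + t)
    linarith
  have h6 : (n * s') * ((s - t) * (s - s')) ≤ (n * s') * 0 := by linarith
  exact le_of_mul_le_mul_left h6 (by positivity)

/-! ### Error bounds for the lasso -/

lemma l1On_pos_of_cone {xi : ℝ} {T : Finset (Fin p)} {u : EuclideanSpace ℝ (Fin p)}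
    (hu : l1On Tᶜ u ≤ xi * l1On T u) (hu0 : u ≠ 0) : 0 < l1On T u := by
  refine (l1On_nonneg T u).lt_of_ne fun h => hu0 (eq_zero_of_l1On_univ ?_)
  rw [← h, mul_zero] at hu
  rw [l1On_univ T, ← h, le_antisymm hu (l1On_nonneg _ _), add_zero]

/-- A nonzero vector in the cone makes κ finite, which allows real arithmetic. The product form
avoids dividing by κ and so includes κ = 0. -/
lemma exists_kappa_eq (X : Matrix (Fin n) (Fin p) ℝ) (hn : 0 < n) {xi : ℝ}
    {T : Finset (Fin p)} {u : EuclideanSpace ℝ (Fin p)}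
    (hu : l1On Tᶜ u ≤ xi * l1On T u) (hu0 : u ≠ 0) :
    ∃ k : ℝ, 0 ≤ k ∧ kappa X xi T = ENNReal.ofReal k ∧
      k ^ 2 * (n * l1On T u ^ 2) ≤ T.card * ‖fit X u‖ ^ 2 := by
  have hle : kappa X xi T
      ≤ ENNReal.ofReal (√(T.card : ℝ) * ‖fit X u‖ / (√(n : ℝ) * l1On T u)) :=
    iInf₂_le u ⟨hu, hu0⟩
  have hpos := l1On_pos_of_cone hu hu0
  have hn' : (0 : ℝ) < n := by exact_mod_cast hn
  have hne : kappa X xi T ≠ ∞ := ne_top_of_le_ne_top ENNReal.ofReal_ne_top hle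
  refine ⟨(kappa X xi T).toReal, ENNReal.toReal_nonneg, (ENNReal.ofReal_toReal hne).symm, ?_⟩
  have h1 : (kappa X xi T).toReal ≤ √(T.card : ℝ) * ‖fit X u‖ / (√(n : ℝ) * l1On T u) :=
    ENNReal.toReal_le_of_le_ofReal (by positivity) hle
  rw [le_div_iff₀ (by positivity)] at h1
  have h2 := pow_le_pow_left₀ (by positivity) h1 2
  rw [mul_pow, mul_pow, mul_pow, Real.sq_sqrt hn'.le, Real.sq_sqrt (Nat.cast_nonneg _)] at h2
  exact h2

/-- The noise level condition: `|ε' X u| ≤ n ρ |u|₁` for all `u`. -/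
def NoiseBound (X : Matrix (Fin n) (Fin p) ℝ) (v : EuclideanSpace ℝ (Fin n)) (rho : ℝ) : Prop :=
  ∀ u, |inner ℝ v (fit X u)| ≤ n * rho * l1On Finset.univ u

/-- The basic inequality of the lasso, multiplied by `(ξ + 1) / 2`. -/
lemma LassoCondition.basic {X : Matrix (Fin n) (Fin p) ℝ} {y : EuclideanSpace ℝ (Fin n)}
    {lam xi rho : ℝ} {b bs : EuclideanSpace ℝ (Fin p)} (hn : 0 < n) (hxi : 1 < xi)
    (h : LassoCondition X y lam b) (hz : NoiseBound X (y - fit X bs) rho)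
    (hrho : rho ≤ lam * ((xi - 1) / (xi + 1))) (hlam : 0 < lam)
    (w : EuclideanSpace ℝ (Fin p)) (T : Finset (Fin p)) :
    (xi + 1) / (2 * lam) * (inner ℝ (fit X (b - bs)) (fit X (b - w)) / n)
      + l1On Tᶜ (b - w) ≤ xi * l1On T (b - w) + (xi + 1) * l1On Tᶜ w := by
  have hn' : (0 : ℝ) < n := by exact_mod_cast hn
  have h1 := h w
  have h2 := (abs_le.1 (hz (b - w))).2
  have h3 : inner ℝ (fit X (b - bs)) (fit X (b - w))
      = inner ℝ (y - fit X bs) (fit X (b - w)) + inner ℝ (y - fit X b) (fit X (w - b)) := by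
    rw [show fit X (w - b) = - fit X (b - w) by rw [fit_sub, fit_sub, neg_sub], inner_neg_right,
      ← sub_eq_add_neg, ← inner_sub_left, fit_sub X b bs]
    congr 1
    abel
  have h4 : n * rho * l1On Finset.univ (b - w)
      ≤ n * (lam * ((xi - 1) / (xi + 1))) * l1On Finset.univ (b - w) := by
    have := l1On_nonneg Finset.univ (b - w)
    gcongr
  rw [l1On_univ T] at h4
  rw [l1On_univ T w, l1On_univ T b] at h1
  have h5 := l1On_le_add_sub T w b
  rw [l1On_sub_comm] at h5
  have h6 : l1On Tᶜ (b - w) ≤ l1On Tᶜ b + l1On Tᶜ w := l1On_sub_le _ _ _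
  have hx : 0 < xi + 1 := by linarith
  set A := l1On T (b - w)
  set C := l1On Tᶜ (b - w)
  have h7 : inner ℝ (fit X (b - bs)) (fit X (b - w)) / n
      ≤ lam * ((xi - 1) / (xi + 1) * (A + C) + A - C + 2 * l1On Tᶜ w) := by
    rw [div_le_iff₀ hn', h3]
    have : n * lam * (l1On T w + l1On Tᶜ w - (l1On T b + l1On Tᶜ b))
        ≤ n * lam * (A - C + 2 * l1On Tᶜ w) := by
      gcongr
      linarith
    rw [l1On_univ T] at h2
    linarith
  have h8 := mul_le_mul_of_nonneg_left h7 (by positivity : 0 ≤ (xi + 1) / (2 * lam))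
  have h9 : (xi + 1) / (2 * lam)
      * (lam * ((xi - 1) / (xi + 1) * (A + C) + A - C + 2 * l1On Tᶜ w))
      = xi * A - C + (xi + 1) * l1On Tᶜ w := by
    field_simp
    ring
  linarith

/-- The `ℓ₁` error of the lasso is at most `μ(λ, ξ)`. -/
lemma LassoCondition.l1_le_muInf {X : Matrix (Fin n) (Fin p) ℝ} {y : EuclideanSpace ℝ (Fin n)}
    {lam xi rho : ℝ} {b bs : EuclideanSpace ℝ (Fin p)} (hn : 0 < n) (hxi : 1 < xi)
    (h : LassoCondition X y lam b) (hz : NoiseBound X (y - fit X bs) rho)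
    (hrho : rho ≤ lam * ((xi - 1) / (xi + 1))) (hlam : 0 < lam) :
    ENNReal.ofReal (l1On Finset.univ (b - bs)) ≤ muInf X bs lam xi := by
  have hn' : (0 : ℝ) < n := by exact_mod_cast hn
  have hx : 0 < xi + 1 := by linarith
  set H := l1On Finset.univ (b - bs) with hH
  have hH0 : 0 ≤ H := l1On_nonneg _ _
  have e : ENNReal.ofReal H = ENNReal.ofReal (xi + 1) * ENNReal.ofReal (H / (xi + 1)) := by
    rw [← ENNReal.ofReal_mul hx.le, mul_div_cancel₀ _ hx.ne']
  rw [e, muInf]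
  refine mul_le_mul_right (le_iInf fun T => le_iInf fun nu => le_iInf fun hnu => ?_) _
  obtain ⟨hnu0, hnu1⟩ := hnu
  have hbas := h.basic hn hxi hz hrho hlam bs T
  rw [real_inner_self_eq_norm_sq] at hbas
  rw [l1On_univ T] at hH
  have hTc := l1On_nonneg Tᶜ bs
  set A := l1On T (b - bs) with hA
  set C := l1On Tᶜ (b - bs) with hC
  set Q := ‖fit X (b - bs)‖ ^ 2 / n with hQ
  have hQ0 : 0 ≤ Q := by positivity
  -- If the first entry of the maximum is too small, then (ξ+1)|β*_{Tᶜ}|₁ < νH. The tail is absorbed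
  -- in the basic inequality, which puts the error in the cone with constant (ξ+ν)/(1−ν).
  rcases le_or_gt (H / (xi + 1)) (l1On Tᶜ bs / nu) with h1 | h1
  · exact (ENNReal.ofReal_le_ofReal h1).trans (le_max_left _ _)
  refine le_trans ?_ (le_max_right _ _)
  rw [div_lt_div_iff₀ hnu0 hx] at h1
  have hnu1' : 0 < 1 - nu := by linarith
  have h2 : (1 - nu) * H + (xi + 1) / (2 * lam) * Q ≤ (xi + 1) * A := by
    rw [hH] at h1 ⊢
    linarith
  have hQ1 : 0 ≤ (xi + 1) / (2 * lam) * Q := by positivity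
  have hcone : C ≤ (xi + nu) / (1 - nu) * A := by
    rw [div_mul_eq_mul_div, le_div_iff₀ hnu1']
    rw [hH] at h2
    linarith
  have hne : b - bs ≠ 0 := by
    intro h0
    have : H = 0 := by rw [hH, hA, hC, h0, l1On_zero, l1On_zero, add_zero]
    rw [this, zero_mul] at h1
    have : 0 ≤ l1On Tᶜ bs * (xi + 1) := by positivity
    linarith
  have hApos : 0 < A := l1On_pos_of_cone hcone hne
  obtain ⟨k, hk0, hk, hkl⟩ := exists_kappa_eq X hn hcone hne
  have hT : 0 < T.card := by
    rcases T.eq_empty_or_nonempty with rfl | hT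
    · simp [l1On] at hA
      linarith
    · exact hT.card_pos
  have hT' : (0 : ℝ) < T.card := by exact_mod_cast hT
  have hkl' : k ^ 2 * A ^ 2 ≤ T.card * Q := by
    rw [hQ, ← mul_div_assoc, le_div_iff₀ hn']
    linarith
  rw [hk, ← ENNReal.ofReal_pow hk0]
  rcases hk0.eq_or_lt with hk0 | hk0
  · rw [← hk0, zero_pow two_ne_zero, ENNReal.ofReal_zero, ENNReal.div_zero]
    · exact le_top
    · rw [Ne, ENNReal.ofReal_eq_zero, not_le]
      positivity
  · rw [← ENNReal.ofReal_div_of_pos (by positivity)]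
    refine ENNReal.ofReal_le_ofReal ?_
    rw [div_le_iff₀ hx, div_div, div_mul_eq_mul_div, le_div_iff₀ (by positivity)]
    have h3 : (xi + 1) / (2 * lam) * (k ^ 2 * A ^ 2 / T.card) ≤ (xi + 1) / (2 * lam) * Q := by
      gcongr
      rw [div_le_iff₀ hT']
      linarith
    have h4 : (1 - nu) * H ≤ (xi + 1) * (A - k ^ 2 * A ^ 2 / (2 * lam * T.card)) := by
      have : (xi + 1) * (A - k ^ 2 * A ^ 2 / (2 * lam * T.card))
        = (xi + 1) * A - (xi + 1) / (2 * lam) * (k ^ 2 * A ^ 2 / T.card) := by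
        field_simp
      linarith
    -- Completing the square: as a quadratic in A, the bracket is at most λ|T|/(2k²).
    have h5 : (A - k ^ 2 * A ^ 2 / (2 * lam * T.card)) * (2 * k ^ 2) ≤ lam * T.card := by
      have e5 : (A - k ^ 2 * A ^ 2 / (2 * lam * T.card)) * (2 * k ^ 2)
          = lam * T.card - (k ^ 2 * A - lam * T.card) ^ 2 / (lam * T.card) := by
        field_simp
        ring
      rw [e5]
      have : 0 ≤ (k ^ 2 * A - lam * T.card) ^ 2 / (lam * T.card) := by positivity
      linarith
    have h6 := mul_le_mul_of_nonneg_right h4 (by positivity : 0 ≤ 2 * k ^ 2)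
    have h7 := mul_le_mul_of_nonneg_left h5 hx.le
    linarith

/-- The prediction error of the lasso is at most `η_*(λ, ξ)`. -/
lemma LassoCondition.norm_sq_le_etaInf {X : Matrix (Fin n) (Fin p) ℝ}
    {y : EuclideanSpace ℝ (Fin n)}
    {lam xi rho : ℝ} {b bs : EuclideanSpace ℝ (Fin p)} (hn : 0 < n) (hxi : 1 < xi)
    (h : LassoCondition X y lam b) (hz : NoiseBound X (y - fit X bs) rho)
    (hrho : rho ≤ lam * ((xi - 1) / (xi + 1))) (hlam : 0 < lam)
    (w : EuclideanSpace ℝ (Fin p)) (T : Finset (Fin p)) :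
    ENNReal.ofReal (‖fit X (b - bs)‖ ^ 2 / n) ≤ eta X bs lam xi w T := by
  have hn' : (0 : ℝ) < n := by exact_mod_cast hn
  have hx : 0 < xi + 1 := by linarith
  -- For this pair the constant 2λ instead of 4λ needs no cone: ρ ≤ λ bounds the noise term by
  -- nλ(|b|₁ + |w|₁), and the terms in |b|₁ cancel.
  by_cases hw : w = bs ∧ T = ∅
  · obtain ⟨rfl, rfl⟩ := hw
    rw [eta, if_pos ⟨rfl, rfl⟩]
    refine le_trans (ENNReal.ofReal_le_ofReal ?_) le_self_add
    simp only [sub_self, norm_zero, add_zero, one_mul, Finset.compl_empty]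
    have h1 := h w
    have h2 := (abs_le.1 (hz (b - w))).2
    have h3 : ‖fit X (b - w)‖ ^ 2
        = inner ℝ (y - fit X w) (fit X (b - w)) + inner ℝ (y - fit X b) (fit X (w - b)) := by
      rw [show fit X (w - b) = - fit X (b - w) by rw [fit_sub, fit_sub, neg_sub],
        inner_neg_right, ← sub_eq_add_neg, ← inner_sub_left,
        show y - fit X w - (y - fit X b) = fit X (b - w) by rw [fit_sub]; abel,
        real_inner_self_eq_norm_sq]
    have h4 := l1On_sub_le Finset.univ b w
    have h5 : n * rho * l1On Finset.univ (b - w)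
        ≤ n * lam * (l1On Finset.univ b + l1On Finset.univ w) := by
      have hr : rho ≤ lam := by
        refine hrho.trans (mul_le_of_le_one_right hlam.le ?_)
        rw [div_le_one hx]
        linarith
      have := l1On_nonneg Finset.univ (b - w)
      have hnl : 0 ≤ n * lam := by positivity
      calc n * rho * l1On Finset.univ (b - w) ≤ n * lam * l1On Finset.univ (b - w) := by gcongr
        _ ≤ _ := by gcongr
    have : ‖fit X (b - w)‖ ^ 2 / n ≤ 2 * lam * l1On Finset.univ w := by
      rw [div_le_iff₀ hn']
      linarith
    simpa using this
  rw [eta, if_neg hw]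
  have hbas := h.basic hn hxi hz hrho hlam w T
  have hTc := l1On_nonneg Tᶜ w
  set G := ‖fit X (b - w)‖ ^ 2 / n with hG
  have hG0 : 0 ≤ G := by positivity
  set P := ‖fit X (b - bs)‖ ^ 2 / n with hP
  set W := ‖fit X bs - fit X w‖ ^ 2 / n with hW
  have hW0 : 0 ≤ W := by positivity
  -- Polarization keeps the error G relative to w on the left beside the error P relative to β*. In
  -- the cone case G pays for the term linear in A.
  have hpol : inner ℝ (fit X (b - bs)) (fit X (b - w)) / n = (P + G - W) / 2 := by
    have : fit X bs - fit X w = fit X (b - w) - fit X (b - bs) := by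
      rw [fit_sub, fit_sub]; abel
    rw [hP, hG, hW, this, norm_sub_sq_real, real_inner_comm]
    ring
  rw [hpol] at hbas
  set A := l1On T (b - w) with hA
  set C := l1On Tᶜ (b - w) with hC
  have h1 : P + G ≤ W + (1 + 1) * 2 * lam * l1On Tᶜ w + 4 * lam / (xi + 1) * (xi * A - C) := by
    have h2 := mul_le_mul_of_nonneg_left hbas (by positivity : 0 ≤ 4 * lam / (xi + 1))
    have e : 4 * lam / (xi + 1) * ((xi + 1) / (2 * lam) * ((P + G - W) / 2) + C)
        = P + G - W + 4 * lam / (xi + 1) * C := by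
      field_simp
      ring
    have e' : 4 * lam / (xi + 1) * (xi * A + (xi + 1) * l1On Tᶜ w)
        = 4 * lam / (xi + 1) * (xi * A) + (1 + 1) * 2 * lam * l1On Tᶜ w := by
      field_simp
      ring
    rw [e, e'] at h2
    linarith
  have hC0 : 0 ≤ C := l1On_nonneg _ _
  have hfac : 0 < 4 * lam / (xi + 1) := by positivity
  -- Outside the cone the last term is nonpositive and the part of η without κ suffices.
  rcases le_or_gt (xi * A) C with h2 | h2
  · refine le_trans (ENNReal.ofReal_le_ofReal ?_) le_self_add
    have : 4 * lam / (xi + 1) * (xi * A - C) ≤ 0 :=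
      mul_nonpos_of_nonneg_of_nonpos hfac.le (by linarith)
    linarith
  have hA0 : 0 < A := by
    by_contra hA0
    have : xi * A ≤ 0 := mul_nonpos_of_nonneg_of_nonpos (by linarith) (not_lt.1 hA0)
    linarith
  have hne : b - w ≠ 0 := by
    intro h0
    rw [hA, h0, l1On_zero] at hA0
    exact lt_irrefl _ hA0
  obtain ⟨k, hk0, hk, hkl⟩ := exists_kappa_eq X hn h2.le hne
  have hT : 0 < T.card := by
    rcases T.eq_empty_or_nonempty with rfl | hT
    · simp [l1On] at hA
      linarith
    · exact hT.card_pos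
  have hT' : (0 : ℝ) < T.card := by exact_mod_cast hT
  have hkl' : k ^ 2 * A ^ 2 ≤ T.card * G := by
    rw [hG, ← mul_div_assoc, le_div_iff₀ hn']
    linarith
  rw [hk, ← ENNReal.ofReal_pow hk0]
  rcases hk0.eq_or_lt with hk0 | hk0
  · rw [← hk0, zero_pow two_ne_zero, ENNReal.ofReal_zero, ENNReal.div_zero]
    · simp
    · rw [Ne, ENNReal.ofReal_eq_zero, not_le]
      positivity
  · rw [← ENNReal.ofReal_div_of_pos (by positivity), ← ENNReal.ofReal_add (by positivity)
      (by positivity)]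
    refine ENNReal.ofReal_le_ofReal ?_
    have h3 : k ^ 2 * A ^ 2 / T.card ≤ G := by
      rw [div_le_iff₀ hT']
      linarith
    have h4 : 4 * lam / (xi + 1) * (xi * A) - k ^ 2 * A ^ 2 / T.card
        ≤ 4 * xi ^ 2 * lam ^ 2 * T.card / (xi + 1) ^ 2 / k ^ 2 := by
      have e : 4 * xi ^ 2 * lam ^ 2 * T.card / (xi + 1) ^ 2 / k ^ 2
          - (4 * lam / (xi + 1) * (xi * A) - k ^ 2 * A ^ 2 / T.card)
          = (2 * xi * lam * T.card / ((xi + 1) * k) - k * A) ^ 2 / T.card := by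
        field_simp
        ring
      have : 0 ≤ (2 * xi * lam * T.card / ((xi + 1) * k) - k * A) ^ 2 / T.card := by positivity
      linarith
    have h5 : 4 * lam / (xi + 1) * (xi * A - C) ≤ 4 * lam / (xi + 1) * (xi * A) := by
      gcongr
      linarith
    linarith

/-! ### Dependence of `μ(λ, ξ)` on `λ` -/

lemma muInf_mono (X : Matrix (Fin n) (Fin p) ℝ) (bs : EuclideanSpace ℝ (Fin p)) {lam lam' : ℝ}
    (xi : ℝ) (h : lam ≤ lam') : muInf X bs lam xi ≤ muInf X bs lam' xi := by
  refine mul_le_mul_right (iInf_mono fun T => iInf_mono fun nu => iInf_mono fun hnu =>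
    max_le_max le_rfl (ENNReal.div_le_div_right (ENNReal.ofReal_le_ofReal ?_) _)) _
  have : 0 < 1 - nu := by linarith [hnu.2]
  gcongr

/-- Inside the maximum one entry is free of λ and the other is linear in λ, so enlarging λ by a
factor c ≥ 1 enlarges μ at most by c. -/
lemma muInf_mul_le (X : Matrix (Fin n) (Fin p) ℝ) (bs : EuclideanSpace ℝ (Fin p)) {c : ℝ}
    (lam xi : ℝ) (h : 1 ≤ c) :
    muInf X bs (c * lam) xi ≤ ENNReal.ofReal c * muInf X bs lam xi := by
  have hc0 : ENNReal.ofReal c ≠ 0 := by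
    rw [Ne, ENNReal.ofReal_eq_zero, not_le]
    linarith
  have hc1 : 1 ≤ ENNReal.ofReal c := by
    rw [← ENNReal.ofReal_one]
    exact ENNReal.ofReal_le_ofReal h
  rw [muInf, muInf, mul_left_comm]
  refine mul_le_mul_right ?_ _
  rw [ENNReal.mul_iInf_of_ne hc0 ENNReal.ofReal_ne_top]
  refine iInf_mono fun T => ?_
  rw [ENNReal.mul_iInf_of_ne hc0 ENNReal.ofReal_ne_top]
  refine iInf_mono fun nu => ?_
  rw [ENNReal.mul_iInf_of_ne hc0 ENNReal.ofReal_ne_top]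
  refine iInf_mono fun hnu => max_le ?_ ?_
  · exact (le_mul_of_one_le_left zero_le hc1).trans (mul_le_mul_right (le_max_left _ _) _)
  · refine le_trans (le_of_eq ?_) (mul_le_mul_right (le_max_right _ _) _)
    rw [mul_assoc, mul_div_assoc, ENNReal.ofReal_mul (by linarith), mul_div_assoc]

/-- The minimum over T is attained, so a positive bound uniform in ν is needed for each T. A nonzero
tail supplies one because ν < 1; otherwise T is nonempty and a coordinate vector bounds κ above.
This settles the degenerate case τ_* = 0. -/
lemma eq_zero_of_muInf_eq_zero {X : Matrix (Fin n) (Fin p) ℝ} {bs : EuclideanSpace ℝ (Fin p)}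
    {lam xi : ℝ} (hlam : 0 < lam) (hxi : 1 < xi) (h : muInf X bs lam xi = 0) :
    bs = 0 := by
  by_contra hbs
  rw [muInf, mul_eq_zero] at h
  have h1 := h.resolve_left (by rw [ENNReal.ofReal_eq_zero, not_le]; linarith)
  obtain ⟨T, hT⟩ := exists_eq_ciInf_of_finite (f := fun T : Finset (Fin p) =>
    ⨅ (nu : ℝ) (_ : 0 < nu ∧ nu < 1), max (ENNReal.ofReal (l1On Tᶜ bs / nu))
      (ENNReal.ofReal (lam * T.card / (2 * (1 - nu)))
        / kappa X ((xi + nu) / (1 - nu)) T ^ 2))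
  rw [h1] at hT
  suffices H : ∃ c : ℝ≥0∞, 0 < c ∧ ∀ nu : ℝ, 0 < nu ∧ nu < 1 →
      c ≤ max (ENNReal.ofReal (l1On Tᶜ bs / nu))
      (ENNReal.ofReal (lam * T.card / (2 * (1 - nu)))
        / kappa X ((xi + nu) / (1 - nu)) T ^ 2) by
    obtain ⟨c, hc0, hc⟩ := H
    have : c ≤ 0 := hT ▸ le_iInf fun nu => le_iInf fun hnu => hc nu hnu
    exact absurd this (not_le.2 hc0)
  rcases (l1On_nonneg Tᶜ bs).eq_or_lt with h0 | h0
  · have hne : T.Nonempty := by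
      by_contra hT0
      rw [Finset.not_nonempty_iff_eq_empty] at hT0
      rw [hT0, Finset.compl_empty] at h0
      exact hbs (eq_zero_of_l1On_univ h0.symm)
    obtain ⟨j, hj⟩ := hne
    have hTpos : (0 : ℝ) < T.card := by exact_mod_cast Finset.card_pos.2 ⟨j, hj⟩
    set u : EuclideanSpace ℝ (Fin p) := EuclideanSpace.single j 1 with hu
    have hu1 : l1On T u = 1 := by
      simp [l1On, hu, apply_ite abs, hj]
    have hu2 : l1On Tᶜ u = 0 := by
      simp [l1On, hu, apply_ite abs, hj]
    have hu0 : u ≠ 0 := by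
      intro h
      rw [h, l1On_zero] at hu1
      exact zero_ne_one hu1
    -- A coordinate vector supported in T lies in every cone with nonnegative constant, so this
    -- bound on κ does not depend on ν.
    set K := ENNReal.ofReal (√(T.card : ℝ) * ‖fit X u‖ / (√(n : ℝ) * l1On T u)) with hK
    refine ⟨ENNReal.ofReal (lam * T.card / 2) / K ^ 2, ?_, fun nu hnu => ?_⟩
    · refine ENNReal.div_pos ?_ (ENNReal.pow_ne_top ENNReal.ofReal_ne_top)
      rw [Ne, ENNReal.ofReal_eq_zero, not_le]
      positivity
    · refine le_trans ?_ (le_max_right _ _)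
      have hnu1 : 0 < 1 - nu := by linarith [hnu.2]
      refine ENNReal.div_le_div (ENNReal.ofReal_le_ofReal ?_) ?_
      · gcongr
        linarith [hnu.1]
      · gcongr
        refine iInf₂_le u ⟨?_, hu0⟩
        rw [hu1, hu2]
        have := hnu.1
        positivity
  · refine ⟨ENNReal.ofReal (l1On Tᶜ bs), by simpa using h0, fun nu hnu => ?_⟩
    refine le_trans (ENNReal.ofReal_le_ofReal ?_) (le_max_left _ _)
    rw [le_div_iff₀ hnu.1]
    exact mul_le_of_le_one_right h0.le hnu.2.le

/-! ### Consistency of the noise level estimate -/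

lemma sq_norm_sub_fit {X : Matrix (Fin n) (Fin p) ℝ} (y : EuclideanSpace ℝ (Fin n))
    (b : EuclideanSpace ℝ (Fin p)) (hn : 0 < n) :
    ‖y - fit X b‖ ^ 2 = n * residualLevel X y b ^ 2 := by
  have hn' : (0 : ℝ) < n := by exact_mod_cast hn
  rw [residualLevel, div_pow, Real.sq_sqrt hn'.le]
  field_simp

lemma pos_of_residualLevel_pos {X : Matrix (Fin n) (Fin p) ℝ} {y : EuclideanSpace ℝ (Fin n)}
    {b : EuclideanSpace ℝ (Fin p)} (h : 0 < residualLevel X y b) : 0 < n := by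
  rcases Nat.eq_zero_or_pos n with rfl | hn
  · simp [residualLevel] at h
  · exact hn

lemma zStar_nonneg (X : Matrix (Fin n) (Fin p) ℝ) (y : EuclideanSpace ℝ (Fin n))
    (bs : EuclideanSpace ℝ (Fin p)) : 0 ≤ zStar X y bs :=
  div_nonneg (Real.iSup_nonneg fun _ => abs_nonneg _)
    (div_nonneg (norm_nonneg _) (Real.sqrt_nonneg _))

lemma abs_inner_col_le {X : Matrix (Fin n) (Fin p) ℝ} {y : EuclideanSpace ℝ (Fin n)}
    {bs : EuclideanSpace ℝ (Fin p)} (h : 0 < residualLevel X y bs) (j : Fin p) :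
    |inner ℝ (col X j) (y - fit X bs)| ≤ n * (residualLevel X y bs * zStar X y bs) := by
  have hn' : (0 : ℝ) < n := by exact_mod_cast pos_of_residualLevel_pos h
  rw [zStar, mul_div_cancel₀ _ h.ne']
  have := le_ciSup (f := fun j : Fin p => |inner ℝ (col X j) (y - fit X bs) / n|)
    (Set.finite_range _).bddAbove j
  simp only [abs_div, abs_of_pos hn'] at this ⊢
  rw [div_le_iff₀ hn'] at this
  linarith

lemma noiseBound_zStar {X : Matrix (Fin n) (Fin p) ℝ} {y : EuclideanSpace ℝ (Fin n)}
    {bs : EuclideanSpace ℝ (Fin p)} (h : 0 < residualLevel X y bs) :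
    NoiseBound X (y - fit X bs) (residualLevel X y bs * zStar X y bs) := by
  intro u
  rw [inner_fit, l1On, Finset.mul_sum]
  refine (Finset.abs_sum_le_sum_abs _ _).trans (Finset.sum_le_sum fun j _ => ?_)
  rw [abs_mul, mul_comm]
  exact mul_le_mul_of_nonneg_right (abs_inner_col_le h j) (abs_nonneg _)

/-- The difference of squares is the inner product of X(b − β*) with the sum of the two residuals.
The noise bound handles one of them; for the other, the variational inequality is tested at β* and
at its reflection 2b − β*, giving both signs. -/
lemma LassoCondition.abs_norm_sq_sub_le {X : Matrix (Fin n) (Fin p) ℝ}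
    {y : EuclideanSpace ℝ (Fin n)} {lam rho : ℝ} {b bs : EuclideanSpace ℝ (Fin p)}
    (h : LassoCondition X y lam b) (hz : NoiseBound X (y - fit X bs) rho) (hlam : 0 ≤ lam) :
    |‖y - fit X bs‖ ^ 2 - ‖y - fit X b‖ ^ 2|
      ≤ n * ((rho + lam) * l1On Finset.univ (b - bs)) := by
  have h0 : 0 ≤ (n : ℝ) * lam := by positivity
  have e : ‖y - fit X bs‖ ^ 2 - ‖y - fit X b‖ ^ 2
      = inner ℝ (y - fit X bs) (fit X (b - bs)) + inner ℝ (y - fit X b) (fit X (b - bs)) := by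
    have : fit X (b - bs) = (y - fit X bs) - (y - fit X b) := by rw [fit_sub]; abel
    rw [this]
    generalize y - fit X bs = v
    generalize y - fit X b = w
    rw [inner_sub_right, inner_sub_right, real_inner_self_eq_norm_sq,
      real_inner_self_eq_norm_sq, real_inner_comm v w]
    ring
  have h1 := abs_le.1 (hz (b - bs))
  have h2 := h bs
  have h3 := h (b + (b - bs))
  rw [show fit X (bs - b) = - fit X (b - bs) by rw [fit_sub, fit_sub, neg_sub],
    inner_neg_right] at h2
  rw [add_sub_cancel_left] at h3
  have h4 := mul_le_mul_of_nonneg_left (l1On_le_add_sub Finset.univ bs b) h0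
  rw [l1On_sub_comm] at h4
  have h5 := mul_le_mul_of_nonneg_left (l1On_add_le Finset.univ b (b - bs)) h0
  rw [e, abs_le]
  constructor <;> linarith

section

variable {X : Matrix (Fin n) (Fin p) ℝ} {y : EuclideanSpace ℝ (Fin n)}
  {bs bhat : EuclideanSpace ℝ (Fin p)} {lam0 xi shat : ℝ}

lemma tauStar_sq (hlam0 : 0 < lam0) (hs : 0 < residualLevel X y bs) :
    tauStar X y bs lam0 xi ^ 2
      = lam0 * mu X bs (residualLevel X y bs * lam0) xi / residualLevel X y bs :=
  Real.sq_sqrt (div_nonneg (mul_nonneg hlam0.le ENNReal.toReal_nonneg) hs.le)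

lemma one_sub_tauStar_sq_nonneg (hlam0 : 0 < lam0) (hxi : 1 < xi)
    (hz : zStar X y bs ≤ (1 - tauStar X y bs lam0 xi ^ 2) * lam0 * (xi - 1) / (xi + 1)) :
    0 ≤ 1 - tauStar X y bs lam0 xi ^ 2 := by
  have h := (zStar_nonneg X y bs).trans hz
  have e : (1 - tauStar X y bs lam0 xi ^ 2) * lam0 * (xi - 1) / (xi + 1)
      = (1 - tauStar X y bs lam0 xi ^ 2) * (lam0 * ((xi - 1) / (xi + 1))) := by ring
  rw [e] at h
  have : 0 < (xi - 1) / (xi + 1) := div_pos (by linarith) (by linarith)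
  exact nonneg_of_mul_nonneg_left h (by positivity)

lemma residual_mul_zStar_le (hs : 0 < residualLevel X y bs)
    (hz : zStar X y bs ≤ (1 - tauStar X y bs lam0 xi ^ 2) * lam0 * (xi - 1) / (xi + 1)) :
    residualLevel X y bs * zStar X y bs ≤ (1 - tauStar X y bs lam0 xi ^ 2)
      * residualLevel X y bs * lam0 * ((xi - 1) / (xi + 1)) := by
  have := mul_le_mul_of_nonneg_left hz hs.le
  refine this.trans (le_of_eq ?_)
  ring

/-- The noise level estimate does not exceed `σ* / (1 - τ_*²)`. -/
lemma IsScaledLasso.one_sub_tauStar_mul_le (hlam0 : 0 < lam0) (hxi : 1 < xi)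
    (hs : 0 < residualLevel X y bs) (h : IsScaledLasso X y lam0 bhat shat)
    (hz : zStar X y bs ≤ (1 - tauStar X y bs lam0 xi ^ 2) * lam0 * (xi - 1) / (xi + 1)) :
    (1 - tauStar X y bs lam0 xi ^ 2) * shat ≤ residualLevel X y bs := by
  have hn := pos_of_residualLevel_pos hs
  have hn' : (0 : ℝ) < n := by exact_mod_cast hn
  have ha := one_sub_tauStar_sq_nonneg hlam0 hxi hz
  have htau := tauStar_sq (X := X) (y := y) (bs := bs) (xi := xi) hlam0 hs
  have hrho := residual_mul_zStar_le hs hz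
  have hnoise := noiseBound_zStar hs
  have hlc := h.lassoCondition hn hlam0.le
  have hnorm := h.norm_sq_eq hn
  have hshat := h.1
  have hnorm' := sq_norm_sub_fit (X := X) y bs hn
  have hrho0 : 0 ≤ residualLevel X y bs * zStar X y bs := mul_nonneg hs.le (zStar_nonneg _ _ _)
  set q := (xi - 1) / (xi + 1) with hq
  have hq0 : 0 < q := div_pos (by linarith) (by linarith)
  have hq1 : q ≤ 1 := by rw [hq, div_le_one (by linarith)]; linarith
  set rho := residualLevel X y bs * zStar X y bs
  set s := residualLevel X y bs
  set a := 1 - tauStar X y bs lam0 xi ^ 2 with hadef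
  have ha1 : a ≤ 1 := by rw [hadef]; linarith [sq_nonneg (tauStar X y bs lam0 xi)]
  by_contra! hcon
  have hshat_ge : s ≤ shat := by nlinarith
  have hM : lam0 * mu X bs (s * lam0) xi = (1 - a) * s := by
    rw [hadef, sub_sub_cancel, htau, div_mul_cancel₀ _ hs.ne']
  have hl1 : l1On Finset.univ (bhat - bs) ≤ shat / s * mu X bs (s * lam0) xi := by
    have h1 := hlc.l1_le_muInf hn hxi hnoise (hrho.trans ?_) (by positivity)
    · have h2 := muInf_mul_le X bs (c := shat / s) (s * lam0) xi (by rwa [one_le_div hs])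
      rw [show shat / s * (s * lam0) = shat * lam0 by field_simp] at h2
      have h3 := h1.trans h2
      rw [← ENNReal.ofReal_toReal (muInf_ne_top X bs (s * lam0) xi),
        ← ENNReal.ofReal_mul (by positivity)] at h3
      exact (ENNReal.ofReal_le_ofReal_iff
        (mul_nonneg (by positivity) ENNReal.toReal_nonneg)).1 h3
    · have : a * s ≤ shat := (mul_le_of_le_one_left hs.le ha1).trans hshat_ge
      gcongr
  have h1 := (abs_le.1 (hlc.abs_norm_sq_sub_le hnoise (by positivity))).1
  have h2 : n * ((rho + shat * lam0) * l1On Finset.univ (bhat - bs))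
      ≤ n * ((a * s * lam0 * q + shat * lam0) * (shat / s * mu X bs (s * lam0) xi)) := by
    have := l1On_nonneg Finset.univ (bhat - bs)
    gcongr
  have h3 : n * ((a * s * lam0 * q + shat * lam0) * (shat / s * mu X bs (s * lam0) xi))
      = n * ((a * s * q + shat) * shat * (1 - a)) := by
    have : (a * s * lam0 * q + shat * lam0) * (shat / s * mu X bs (s * lam0) xi)
      = (a * s * q + shat) * shat / s * (lam0 * mu X bs (s * lam0) xi) := by ring
    rw [this, hM]
    field_simp
  rw [hnorm, hnorm'] at h1
  have h4 : n * (shat ^ 2 - s ^ 2) ≤ n * ((a * s * q + shat) * shat * (1 - a)) := by linarith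
  have h5 := le_of_mul_le_mul_left h4 hn'
  have h6 : s * shat < a * shat * shat := mul_lt_mul_of_pos_right hcon hshat
  have h7 : s * (shat - s) < s * ((1 - a) * a * q * shat) := by linarith
  have h8 := lt_of_mul_lt_mul_left h7 hs.le
  have h9 : shat * ((1 - a) * (1 - a * q)) < shat * 0 := by linarith
  have h10 := lt_of_mul_lt_mul_left h9 hshat.le
  have h11 : 0 ≤ (1 - a) * (1 - a * q) := by
    refine mul_nonneg (by linarith) ?_
    have := mul_le_one₀ ha1 hq0.le hq1
    linarith
  linarith

/-- The noise level estimate is at least `(1 - τ_*²) σ*`. -/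
lemma IsScaledLasso.one_sub_tauStar_mul_residual_le (hlam0 : 0 < lam0) (hxi : 1 < xi)
    (hs : 0 < residualLevel X y bs) (h : IsScaledLasso X y lam0 bhat shat)
    (hz : zStar X y bs ≤ (1 - tauStar X y bs lam0 xi ^ 2) * lam0 * (xi - 1) / (xi + 1)) :
    (1 - tauStar X y bs lam0 xi ^ 2) * residualLevel X y bs ≤ shat := by
  have hn := pos_of_residualLevel_pos hs
  have hn' : (0 : ℝ) < n := by exact_mod_cast hn
  have ha := one_sub_tauStar_sq_nonneg hlam0 hxi hz
  have htau := tauStar_sq (X := X) (y := y) (bs := bs) (xi := xi) hlam0 hs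
  have hrho := residual_mul_zStar_le hs hz
  have hnoise := noiseBound_zStar hs
  have hlc := h.lassoCondition hn hlam0.le
  have hnorm := h.norm_sq_eq hn
  have hshat := h.1
  have hnorm' := sq_norm_sub_fit (X := X) y bs hn
  have hrho0 : 0 ≤ residualLevel X y bs * zStar X y bs := mul_nonneg hs.le (zStar_nonneg _ _ _)
  set q := (xi - 1) / (xi + 1) with hq
  have hq0 : 0 < q := div_pos (by linarith) (by linarith)
  have hq1 : q < 1 := by rw [hq, div_lt_one (by linarith)]; linarith
  set rho := residualLevel X y bs * zStar X y bs
  set s := residualLevel X y bs with hsdef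
  set a := 1 - tauStar X y bs lam0 xi ^ 2 with hadef
  have ha1 : a ≤ 1 := by rw [hadef]; linarith [sq_nonneg (tauStar X y bs lam0 xi)]
  by_contra! hcon
  have hapos : 0 < a := by
    by_contra h0
    rw [le_antisymm (not_lt.1 h0) ha, zero_mul] at hcon
    linarith
  have hM : lam0 * mu X bs (s * lam0) xi = (1 - a) * s := by
    rw [hadef, sub_sub_cancel, htau, div_mul_cancel₀ _ hs.ne']
  have ht : 0 < a * s := by positivity
  -- For a < 1 the lasso at penalty a s λ₀ has residual level t with t > a s > σ̂, contradicting the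
  -- comparison of two penalties. For a = 1 that strict inequality is lost, but then μ = 0 and β* =
  -- 0, and the variational inequality forces β̂ = 0, hence σ̂ = s.
  rcases ha1.lt_or_eq with ha1 | ha1
  · obtain ⟨b, hb⟩ := exists_lassoCondition X y (lam := a * s * lam0) (by positivity) hn
    have hbn := sq_norm_sub_fit (X := X) y b hn
    have hb0 : 0 ≤ residualLevel X y b := by unfold residualLevel; positivity
    set t := residualLevel X y b
    have hl1 : l1On Finset.univ (b - bs) ≤ mu X bs (s * lam0) xi := by
      have h1 := hb.l1_le_muInf hn hxi hnoise hrho (by positivity)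
      have h2 := muInf_mono X bs (lam := a * s * lam0) (lam' := s * lam0) xi (by
        rw [mul_assoc]
        exact mul_le_of_le_one_left (by positivity) ha1.le)
      exact (ENNReal.ofReal_le_iff_le_toReal (muInf_ne_top X bs (s * lam0) xi)).1 (h1.trans h2)
    have h1 := (abs_le.1 (hb.abs_norm_sq_sub_le hnoise (by positivity))).2
    have h2 : n * ((rho + a * s * lam0) * l1On Finset.univ (b - bs))
        ≤ n * ((a * s * lam0 * q + a * s * lam0) * mu X bs (s * lam0) xi) := by
      have := l1On_nonneg Finset.univ (b - bs)
      gcongr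
    have h3 : n * ((a * s * lam0 * q + a * s * lam0) * mu X bs (s * lam0) xi)
        = n * (a * s ^ 2 * (q + 1) * (1 - a)) := by
      have : (a * s * lam0 * q + a * s * lam0) * mu X bs (s * lam0) xi
        = a * s * (q + 1) * (lam0 * mu X bs (s * lam0) xi) := by ring
      rw [this, hM]
      ring
    rw [hbn, hnorm'] at h1
    have h4 : n * (s ^ 2 - t ^ 2) ≤ n * (a * s ^ 2 * (q + 1) * (1 - a)) := by linarith
    have h5 := le_of_mul_le_mul_left h4 hn'
    have h6 : 0 < s ^ 2 * ((1 - a) * (1 - a * q)) := by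
      have : a * q < 1 := mul_lt_one_of_nonneg_of_lt_one_left ha ha1 hq1.le
      have h7 : 0 < 1 - a * q := by linarith
      have h8 : 0 < 1 - a := by linarith
      positivity
    have h7 : (a * s) ^ 2 < t ^ 2 := by linarith
    have h8 : a * s < t := lt_of_pow_lt_pow_left₀ 2 hb0 h7
    have h9 := hb.mul_sub_nonpos hn ht hshat hb0 hlc hbn hnorm
    have h10 : 0 < (t - a * s) * (t - shat) := mul_pos (by linarith) (by linarith)
    linarith
  · rw [ha1, one_mul] at hcon
    rw [ha1, one_mul] at hrho
    rw [ha1, sub_self, zero_mul, mul_eq_zero] at hM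
    have hmu : muInf X bs (s * lam0) xi = 0 := by
      have := hM.resolve_left hlam0.ne'
      rw [mu, ENNReal.toReal_eq_zero_iff] at this
      exact this.resolve_right (muInf_ne_top _ _ _ _)
    have hbs := eq_zero_of_muInf_eq_zero (by positivity) hxi hmu
    have h1 := (abs_le.1 (hnoise bhat)).2
    have h2 := hlc bs
    rw [hbs, zero_sub, l1On_zero, show fit X (-bhat) = (y - fit X bhat) - y by
      rw [← zero_sub, fit_sub, fit_zero]; abel, inner_sub_right, real_inner_self_eq_norm_sq,
      hnorm] at h2
    rw [hbs, fit_zero, sub_zero] at h1 hnorm'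
    rw [show fit X bhat = y - (y - fit X bhat) by abel, inner_sub_right,
      real_inner_self_eq_norm_sq, hnorm', real_inner_comm] at h1
    have hc : inner ℝ (y - fit X bhat) y ≤ n * (s * shat) := by
      refine (real_inner_le_norm _ _).trans (abs_le_of_sq_le_sq' ?_ (by positivity)).2
      rw [mul_pow, hnorm, hnorm']
      exact le_of_eq (by ring)
    set c := inner ℝ (y - fit X bhat) y
    have hl0 := l1On_nonneg Finset.univ bhat
    have h1' : n * s ^ 2 - c ≤ n * (s * lam0 * q) * l1On Finset.univ bhat := by
      refine h1.trans ?_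
      gcongr
    have h3 := mul_le_mul_of_nonneg_left h1' hshat.le
    have h4 := mul_le_mul_of_nonneg_left h2 hs.le
    have h5 := mul_le_mul_of_nonneg_left hc (by positivity : 0 ≤ s + shat)
    have h6 : (n * s * shat * lam0) * ((1 - q) * l1On Finset.univ bhat)
        ≤ (n * s * shat * lam0) * 0 := by linarith
    have h7 := le_of_mul_le_mul_left h6 (by positivity)
    have h8 : l1On Finset.univ bhat = 0 := by
      refine le_antisymm ?_ hl0
      by_contra! h8
      have : 0 < (1 - q) * l1On Finset.univ bhat := mul_pos (by linarith) h8
      linarith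
    rw [eq_zero_of_l1On_univ h8, fit_zero, sub_zero, hnorm'] at hnorm
    have h9 := mul_left_cancel₀ hn'.ne' hnorm
    rw [pow_left_inj₀ hs.le hshat.le two_ne_zero] at h9
    linarith

end

/-! ### Rayleigh quotients and sparse eigenvalues -/

section Rayleigh

variable {ι : Type*} [Fintype ι] [DecidableEq ι]

lemma hasEigenvalue_of_mulVec_eq {M : Matrix ι ι ℝ} {x : ι → ℝ} {e : ℝ} (hx : x ≠ 0)
    (h : M.mulVec x = e • x) : Module.End.HasEigenvalue (Matrix.toLin' M) e := by
  refine Module.End.hasEigenvalue_of_hasEigenvector (x := x)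
    (Module.End.hasEigenvector_iff.2 ⟨?_, hx⟩)
  rw [Module.End.mem_eigenspace_iff, Matrix.toLin'_apply, h]

lemma eigenvectorBasis_ofLp_ne_zero {M : Matrix ι ι ℝ} (hM : M.IsHermitian) (i : ι) :
    (hM.eigenvectorBasis i).ofLp ≠ 0 := by
  intro h
  refine hM.eigenvectorBasis.orthonormal.ne_zero i ?_
  ext j
  exact congrFun h j

lemma mul_dotProduct_le_of_le_eigenvalue {M : Matrix ι ι ℝ} (hM : M.IsHermitian) {k : ℝ}
    (h : ∀ e, Module.End.HasEigenvalue (Matrix.toLin' M) e → k ≤ e) (w : ι → ℝ) :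
    k * (w ⬝ᵥ w) ≤ w ⬝ᵥ M.mulVec w := by
  have hN : (M - k • (1 : Matrix ι ι ℝ)).IsHermitian :=
    hM.sub (by simp [Matrix.IsHermitian])
  have hpos : (M - k • (1 : Matrix ι ι ℝ)).PosSemidef := by
    rw [hN.posSemidef_iff_eigenvalues_nonneg]
    intro i
    have h1 := hN.mulVec_eigenvectorBasis i
    rw [Matrix.sub_mulVec, Matrix.smul_mulVec, Matrix.one_mulVec, sub_eq_iff_eq_add,
      ← add_smul] at h1
    have h2 := h _ (hasEigenvalue_of_mulVec_eq (eigenvectorBasis_ofLp_ne_zero hN i) h1)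
    simp only [Pi.zero_apply]
    linarith
  have h3 := hpos.dotProduct_mulVec_nonneg w
  rw [star_trivial, Matrix.sub_mulVec, Matrix.smul_mulVec, Matrix.one_mulVec, dotProduct_sub,
    dotProduct_smul, smul_eq_mul] at h3
  linarith

lemma dotProduct_le_mul_of_eigenvalue_le {M : Matrix ι ι ℝ} (hM : M.IsHermitian) {k : ℝ}
    (h : ∀ e, Module.End.HasEigenvalue (Matrix.toLin' M) e → e ≤ k) (w : ι → ℝ) :
    w ⬝ᵥ M.mulVec w ≤ k * (w ⬝ᵥ w) := by
  have h1 := mul_dotProduct_le_of_le_eigenvalue (k := -k) hM.neg (fun e he => ?_) w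
  · rw [Matrix.neg_mulVec, dotProduct_neg] at h1
    linarith
  · obtain ⟨x, hx⟩ := he.exists_hasEigenvector
    have hx1 := hx.apply_eq_smul
    rw [Matrix.toLin'_apply, Matrix.neg_mulVec, neg_eq_iff_eq_neg, ← neg_smul] at hx1
    have := h _ (hasEigenvalue_of_mulVec_eq hx.2 hx1)
    linarith

end Rayleigh

lemma sum_subtype_eq_of_supp {B : Finset (Fin p)} {u : EuclideanSpace ℝ (Fin p)}
    (hu : supp u ⊆ B) (f : Fin p → ℝ) : ∑ j : B, f j * u j = ∑ j, f j * u j := by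
  rw [Finset.sum_coe_sort B (fun j => f j * u j)]
  refine Finset.sum_subset (Finset.subset_univ _) fun j _ hj => ?_
  have : u j = 0 := by
    by_contra h
    exact hj (hu (by simpa [supp] using h))
  rw [this, mul_zero]

lemma isHermitian_gram (X : Matrix (Fin n) (Fin p) ℝ) (B : Finset (Fin p)) :
    (gram X B).IsHermitian := by
  simp [gram, Matrix.IsHermitian, Matrix.conjTranspose_eq_transpose_of_trivial]

lemma dotProduct_gram_mulVec (X : Matrix (Fin n) (Fin p) ℝ) {B : Finset (Fin p)}
    {u : EuclideanSpace ℝ (Fin p)} (hu : supp u ⊆ B) :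
    (fun j : B => u j) ⬝ᵥ (gram X B).mulVec (fun j : B => u j) = ‖fit X u‖ ^ 2 / n := by
  have h1 : (X.submatrix id (Subtype.val : B → Fin p)).mulVec (fun j : B => u j)
      = (fit X u).ofLp := by
    ext i
    simp only [Matrix.mulVec, dotProduct, Matrix.submatrix_apply, id, fit]
    exact sum_subtype_eq_of_supp hu (X i)
  rw [gram, Matrix.smul_mulVec, ← Matrix.mulVec_mulVec, h1, dotProduct_smul,
    Matrix.dotProduct_mulVec, Matrix.vecMul_transpose, h1, EuclideanSpace.norm_sq_eq]
  simp only [dotProduct, Real.norm_eq_abs, sq_abs, smul_eq_mul, ← sq]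
  rw [div_eq_inv_mul]

lemma dotProduct_eq_norm_sq {B : Finset (Fin p)}
    {u : EuclideanSpace ℝ (Fin p)} (hu : supp u ⊆ B) :
    (fun j : B => u j) ⬝ᵥ (fun j : B => u j) = ‖u‖ ^ 2 := by
  rw [dotProduct, sum_subtype_eq_of_supp hu (fun j => u j), EuclideanSpace.norm_sq_eq]
  simp [sq]

lemma kappaMinus_mul_le (X : Matrix (Fin n) (Fin p) ℝ) {m : ℕ} {T B : Finset (Fin p)}
    (hTB : T ⊆ B) (hB : (B \ T).card ≤ m) {u : EuclideanSpace ℝ (Fin p)} (hu : supp u ⊆ B) :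
    kappaMinus X m T * ENNReal.ofReal (‖u‖ ^ 2) ≤ ENNReal.ofReal (‖fit X u‖ ^ 2 / n) := by
  have hle : ∀ e, Module.End.HasEigenvalue (Matrix.toLin' (gram X B)) e →
      kappaMinus X m T ≤ ENNReal.ofReal e := fun e he =>
    (iInf₂_le B ⟨hTB, hB⟩).trans (iInf₂_le e he)
  -- For empty B the factor κ₋ may be ∞, but then u = 0 and the product is 0.
  rcases B.eq_empty_or_nonempty with rfl | ⟨j, hj⟩
  · have : u = 0 := eq_zero_of_l1On_univ (by
      rw [← Finset.compl_empty, ← Finset.subset_empty.1 hu, l1On_compl_supp])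
    simp [this]
  have htop : kappaMinus X m T ≠ ∞ := by
    refine ne_top_of_le_ne_top ENNReal.ofReal_ne_top (hle _ (hasEigenvalue_of_mulVec_eq
      (eigenvectorBasis_ofLp_ne_zero (isHermitian_gram X B) ⟨j, hj⟩)
      ((isHermitian_gram X B).mulVec_eigenvectorBasis ⟨j, hj⟩)))
  have hk : ∀ e, Module.End.HasEigenvalue (Matrix.toLin' (gram X B)) e →
      (kappaMinus X m T).toReal ≤ max e 0 := fun e he =>
    ENNReal.toReal_le_of_le_ofReal (le_max_right _ _)
      ((hle e he).trans (ENNReal.ofReal_le_ofReal (le_max_left _ _)))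
  have hnn : ∀ e, Module.End.HasEigenvalue (Matrix.toLin' (gram X B)) e → 0 ≤ e := by
    intro e he
    obtain ⟨x, hx⟩ := he.exists_hasEigenvector
    have hx1 := hx.apply_eq_smul
    rw [Matrix.toLin'_apply] at hx1
    have h1 : 0 ≤ x ⬝ᵥ (gram X B).mulVec x := by
      rw [gram, Matrix.smul_mulVec, ← Matrix.mulVec_mulVec, dotProduct_smul,
        Matrix.dotProduct_mulVec, Matrix.vecMul_transpose, smul_eq_mul]
      exact mul_nonneg (by positivity) (Finset.sum_nonneg fun i _ => mul_self_nonneg _)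
    rw [hx1, dotProduct_smul, smul_eq_mul] at h1
    have h2 : 0 < x ⬝ᵥ x := by
      refine lt_of_le_of_ne (Finset.sum_nonneg fun i _ => mul_self_nonneg _) fun h => hx.2 ?_
      exact dotProduct_self_eq_zero.1 h.symm
    exact nonneg_of_mul_nonneg_left h1 h2
  rw [← ENNReal.ofReal_toReal htop, ← ENNReal.ofReal_mul ENNReal.toReal_nonneg]
  refine ENNReal.ofReal_le_ofReal ?_
  rw [← dotProduct_gram_mulVec X hu, ← dotProduct_eq_norm_sq hu]
  exact mul_dotProduct_le_of_le_eigenvalue (isHermitian_gram X B)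
    (fun e he => (hk e he).trans (max_le le_rfl (hnn e he))) _

/-- The squared correlations of a vector with the columns in `B` sum to at most `n κ₊ ‖v‖²`. -/
lemma sum_inner_col_sq_le (X : Matrix (Fin n) (Fin p) ℝ) (hn : 0 < n) {m : ℕ}
    {T B : Finset (Fin p)} (hBT : Disjoint B T) (hB : B.card ≤ m) (htop : kappaPlus X m T ≠ ∞)
    (v : EuclideanSpace ℝ (Fin n)) :
    ∑ j ∈ B, inner ℝ (col X j) v ^ 2 ≤ n * (kappaPlus X m T).toReal * ‖v‖ ^ 2 := by
  have hn' : (0 : ℝ) < n := by exact_mod_cast hn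
  have hle : ∀ e, Module.End.HasEigenvalue (Matrix.toLin' (gram X B)) e →
      e ≤ (kappaPlus X m T).toReal := fun e he =>
    (ENNReal.ofReal_le_iff_le_toReal htop).1
      ((le_iSup₂ (f := fun (e : ℝ) (_ : Module.End.HasEigenvalue (Matrix.toLin' (gram X B)) e) =>
        ENNReal.ofReal e) e he).trans
        (le_iSup₂ (f := fun (B : Finset (Fin p)) (_ : Disjoint B T ∧ B.card ≤ m) =>
          ⨆ (e : ℝ) (_ : Module.End.HasEigenvalue (Matrix.toLin' (gram X B)) e),
          ENNReal.ofReal e) B ⟨hBT, hB⟩))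
  -- The vector of correlations satisfies ‖u‖² = ⟨v, Xu⟩, so Cauchy–Schwarz turns the Rayleigh bound
  -- on ‖Xu‖ into a bound on ‖u‖ itself.
  set u : EuclideanSpace ℝ (Fin p) :=
    WithLp.toLp 2 (fun j => if j ∈ B then inner ℝ (col X j) v else 0) with hu
  have huB : supp u ⊆ B := by
    intro j hj
    by_contra h
    simp [supp, hu, h] at hj
  have h1 : ∑ j ∈ B, inner ℝ (col X j) v ^ 2 = ‖u‖ ^ 2 := by
    rw [EuclideanSpace.norm_sq_eq]
    simp [hu, ite_pow, Finset.sum_ite_mem]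
  have h2 : ‖u‖ ^ 2 = inner ℝ v (fit X u) := by
    rw [← h1, inner_fit]
    simp [hu, ite_mul, Finset.sum_ite_mem, sq]
  have h3 := dotProduct_le_mul_of_eigenvalue_le (isHermitian_gram X B) hle (fun j : B => u j)
  rw [dotProduct_gram_mulVec X huB, dotProduct_eq_norm_sq huB, div_le_iff₀ hn'] at h3
  have h4 : ‖u‖ ^ 2 ≤ ‖v‖ * ‖fit X u‖ := h2 ▸ real_inner_le_norm _ _
  rw [h1]
  rcases (sq_nonneg ‖u‖).eq_or_lt with h0 | h0
  · rw [← h0]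
    positivity
  · have h5 := pow_le_pow_left₀ h0.le h4 2
    have h6 : ‖u‖ ^ 2 * ‖u‖ ^ 2 ≤ ‖u‖ ^ 2 * (n * (kappaPlus X m T).toReal * ‖v‖ ^ 2) := by
      have := mul_le_mul_of_nonneg_left h3 (sq_nonneg ‖v‖)
      nlinarith
    exact le_of_mul_le_mul_left h6 h0

/-! ### Projections onto column spans -/

lemma fit_mem_span (X : Matrix (Fin n) (Fin p) ℝ) {B : Finset (Fin p)}
    {u : EuclideanSpace ℝ (Fin p)} (hu : supp u ⊆ B) :
    fit X u ∈ Submodule.span ℝ (col X '' (B : Set (Fin p))) := by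
  rw [fit_eq_sum]
  refine Submodule.sum_mem _ fun j _ => ?_
  by_cases hj : j ∈ B
  · exact Submodule.smul_mem _ _ (Submodule.subset_span ⟨j, hj, rfl⟩)
  · have : u j = 0 := by
      by_contra h
      exact hj (hu (by simpa [supp] using h))
    rw [this, zero_smul]
    exact Submodule.zero_mem _

lemma exists_fit_eq_of_mem_span (X : Matrix (Fin n) (Fin p) ℝ) {B : Finset (Fin p)}
    {v : EuclideanSpace ℝ (Fin n)} (hv : v ∈ Submodule.span ℝ (col X '' (B : Set (Fin p)))) :
    ∃ u, supp u ⊆ B ∧ fit X u = v := by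
  obtain ⟨c, hc⟩ := (Submodule.mem_span_image_finset_iff_exists_fun ℝ).1 hv
  refine ⟨WithLp.toLp 2 (fun j => if h : j ∈ B then c ⟨j, h⟩ else 0), fun j hj => ?_, ?_⟩
  · by_contra h
    simp [supp, h] at hj
  · rw [← hc, fit_eq_sum]
    rw [← Finset.sum_subset (Finset.subset_univ B) (fun j _ hj => by simp [hj]),
      ← Finset.sum_coe_sort]
    exact Finset.sum_congr rfl fun j _ => by simp

lemma norm_sub_sq_of_mem {E : Type*} [NormedAddCommGroup E] [InnerProductSpace ℝ E]
    (K : Submodule ℝ E) [K.HasOrthogonalProjection] (y : E) {v : E} (hv : v ∈ K) :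
    ‖y - v‖ ^ 2 = ‖y - K.starProjection y‖ ^ 2 + ‖K.starProjection y - v‖ ^ 2 := by
  rw [← sub_add_sub_cancel y (K.starProjection y) v, norm_add_sq_real,
    Submodule.starProjection_inner_eq_zero _ _
      (K.sub_mem (Submodule.starProjection_apply_mem K y) hv)]
  ring

lemma IsRefit.fit_eq_proj {X : Matrix (Fin n) (Fin p) ℝ} {y : EuclideanSpace ℝ (Fin n)}
    {bhat bbar : EuclideanSpace ℝ (Fin p)} (h : IsRefit X y bhat bbar) :
    fit X bbar = proj X (supp bhat) y := by
  set K := Submodule.span ℝ (col X '' (supp bhat : Set (Fin p))) with hK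
  obtain ⟨u, hu, hu'⟩ := exists_fit_eq_of_mem_span X (Submodule.starProjection_apply_mem K y)
  have h1 := h.2 u hu
  rw [hu', norm_sub_sq_of_mem K y (fit_mem_span X h.1)] at h1
  have h2 : ‖K.starProjection y - fit X bbar‖ ^ 2 = 0 :=
    le_antisymm (by linarith) (sq_nonneg _)
  rw [sq_eq_zero_iff, norm_eq_zero, sub_eq_zero] at h2
  exact h2.symm

lemma norm_proj_le_of_subset (X : Matrix (Fin n) (Fin p) ℝ) {B D : Finset (Fin p)} (h : B ⊆ D)
    (v : EuclideanSpace ℝ (Fin n)) : ‖proj X B v‖ ≤ ‖proj X D v‖ := by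
  have hle : Submodule.span ℝ (col X '' (B : Set (Fin p)))
      ≤ Submodule.span ℝ (col X '' (D : Set (Fin p))) :=
    Submodule.span_mono (Set.image_mono (by exact_mod_cast h))
  rw [proj, proj, ← Submodule.starProjection_comp_starProjection_of_le hle]
  exact Submodule.norm_starProjection_apply_le _ _

/-- The set D is enlarged to an admissible B containing S, which can only increase the projection;
this passes from "at most m" to "exactly m, or all indices". -/
lemma norm_proj_le_sigmaStar (X : Matrix (Fin n) (Fin p) ℝ) (y : EuclideanSpace ℝ (Fin n))
    (bs : EuclideanSpace ℝ (Fin p)) (hn : 0 < n) {m : ℕ} {D : Finset (Fin p)}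
    (hD : (D \ supp bs).card ≤ m) :
    ‖proj X D (y - fit X bs)‖ ≤ √(n : ℝ) * sigmaStar X y bs m := by
  have hn' : (0 : ℝ) < n := by exact_mod_cast hn
  have hsub : D \ supp bs ⊆ (supp bs)ᶜ := fun j hj => by
    simpa using (Finset.mem_sdiff.1 hj).2
  obtain ⟨C, hC1, hC2, hC3⟩ := Finset.exists_subsuperset_card_eq hsub
    (le_min hD (Finset.card_le_card hsub)) (min_le_right m _)
  have hdis : Disjoint C (supp bs) := by
    rw [Finset.disjoint_left]
    exact fun j hj => by simpa using hC2 hj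
  have hB : supp bs ⊆ C ∪ supp bs ∧ ((C ∪ supp bs) \ supp bs).card = min m (supp bs)ᶜ.card := by
    refine ⟨Finset.subset_union_right, ?_⟩
    rw [Finset.union_sdiff_right, Finset.sdiff_eq_self_of_disjoint hdis, hC3]
  have hDB : D ⊆ C ∪ supp bs := by
    intro j hj
    by_cases h : j ∈ supp bs
    · exact Finset.mem_union_right _ h
    · exact Finset.mem_union_left _ (hC1 (Finset.mem_sdiff.2 ⟨hj, h⟩))
  refine (norm_proj_le_of_subset X hDB _).trans ?_
  have := le_ciSup (f := fun B : {B : Finset (Fin p) //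
      supp bs ⊆ B ∧ (B \ supp bs).card = min m ((supp bs)ᶜ).card} =>
    ‖proj X B.1 (y - fit X bs)‖ / √(n : ℝ)) (Set.finite_range _).bddAbove ⟨C ∪ supp bs, hB⟩
  rw [div_le_iff₀ (by positivity)] at this
  rw [mul_comm]
  exact this

/-! ### False positives and the least squares refit -/

/-- The variational inequality is tested at the vector obtained from `b` by deleting its active
coordinate j. -/
lemma LassoCondition.mul_le_abs_inner_col {X : Matrix (Fin n) (Fin p) ℝ}
    {y : EuclideanSpace ℝ (Fin n)} {lam : ℝ} {b : EuclideanSpace ℝ (Fin p)}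
    (h : LassoCondition X y lam b) {j : Fin p} (hj : j ∈ supp b) :
    n * lam ≤ |inner ℝ (col X j) (y - fit X b)| := by
  have hj' : b j ≠ 0 := by simpa [supp] using hj
  have h1 := h (b + EuclideanSpace.single j (-b j))
  rw [add_sub_cancel_left, inner_fit] at h1
  have h2 : l1On Finset.univ (b + EuclideanSpace.single j (-b j)) - l1On Finset.univ b
      = -|b j| := by
    rw [l1On, l1On, ← Finset.sum_sub_distrib, Finset.sum_eq_single j]
    · simp
    · intro i _ hi
      simp [hi]
    · simp
  rw [h2, Finset.sum_eq_single j] at h1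
  · simp only [PiLp.single_apply, if_true] at h1
    have h3 := le_abs_self (b j * inner ℝ (col X j) (y - fit X b))
    rw [abs_mul] at h3
    have h4 : |b j| * (n * lam) ≤ |b j| * |inner ℝ (col X j) (y - fit X b)| := by linarith
    exact le_of_mul_le_mul_left h4 (abs_pos.2 hj')
  · intro i _ hi
    simp [hi]
  · simp

/-- If m false positives existed, each would contribute at least (2nλ/(ξ+1))² to the squared
correlations with X(b − β*). Their sum is at most nκ₊‖X(b − β*)‖², and bounding this norm by η at w
= β*, T = S contradicts the sparsity assumption. -/
lemma LassoCondition.card_sdiff_lt {X : Matrix (Fin n) (Fin p) ℝ}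
    {y : EuclideanSpace ℝ (Fin n)} {lam xi rho : ℝ} {b bs : EuclideanSpace ℝ (Fin p)}
    (hn : 0 < n) (hxi : 1 < xi) (h : LassoCondition X y lam b)
    (hz : ∀ j, |inner ℝ (col X j) (y - fit X bs)| ≤ n * rho)
    (hrho : rho ≤ lam * ((xi - 1) / (xi + 1))) (hlam : 0 < lam)
    (hpred : ENNReal.ofReal (‖fit X (b - bs)‖ ^ 2 / n) ≤ eta X bs lam xi bs (supp bs)) {m : ℕ}
    (hm : ((supp bs).card : ℝ≥0∞) * ENNReal.ofReal (xi ^ 2) / kappa X xi (supp bs) ^ 2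
        < (m : ℝ≥0∞) / kappaPlus X m (supp bs)) :
    (supp b \ supp bs).card < m := by
  have hn' : (0 : ℝ) < n := by exact_mod_cast hn
  have hx : 0 < xi + 1 := by linarith
  by_contra! hcon
  -- Both m = 0 and κ₊ = ∞ would make the right side of the sparsity assumption equal to 0.
  have hm0 : m ≠ 0 := by
    rintro rfl
    simp at hm
  have htop : kappaPlus X m (supp bs) ≠ ∞ := by
    intro h
    rw [h, ENNReal.div_top] at hm
    exact not_lt_zero hm
  obtain ⟨B, hB, hBm⟩ := Finset.exists_subset_card_eq hcon
  have hdis : Disjoint B (supp bs) := by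
    rw [Finset.disjoint_left]
    exact fun j hj => (Finset.mem_sdiff.1 (hB hj)).2
  have hsum := sum_inner_col_sq_le X hn hdis hBm.le htop (fit X (b - bs))
  have hlow : ∀ j ∈ B, (n * (2 * lam / (xi + 1))) ^ 2
      ≤ inner ℝ (col X j) (fit X (b - bs)) ^ 2 := by
    intro j hj
    have h1 := h.mul_le_abs_inner_col (Finset.mem_sdiff.1 (hB hj)).1
    have h2 := hz j
    have h3 : fit X (b - bs) = (y - fit X bs) - (y - fit X b) := by rw [fit_sub]; abel
    rw [← sq_abs (inner ℝ (col X j) (fit X (b - bs))), h3, inner_sub_right]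
    have h4 := abs_sub_abs_le_abs_sub (inner ℝ (col X j) (y - fit X b))
      (inner ℝ (col X j) (y - fit X bs))
    rw [abs_sub_comm] at h4
    refine pow_le_pow_left₀ (by positivity) ?_ 2
    have h5 : n * rho ≤ n * (lam * ((xi - 1) / (xi + 1))) := by gcongr
    have h6 : (n : ℝ) * (2 * lam / (xi + 1)) = n * lam - n * (lam * ((xi - 1) / (xi + 1))) := by
      field_simp
      ring
    linarith
  have hsum2 := Finset.card_nsmul_le_sum B _ _ hlow
  rw [hBm, nsmul_eq_mul] at hsum2
  set K := (kappaPlus X m (supp bs)).toReal with hK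
  set c := 4 * lam ^ 2 / (xi + 1) ^ 2 with hc
  have hc0 : 0 < c := by positivity
  set P := ‖fit X (b - bs)‖ ^ 2 / n with hP
  have hP0 : 0 ≤ P := by positivity
  have hKP : m * c ≤ K * P := by
    have h1 : (n : ℝ) ^ 2 * (m * c) ≤ (n : ℝ) ^ 2 * (K * P) := by
      calc (n : ℝ) ^ 2 * (m * c) = m * (n * (2 * lam / (xi + 1))) ^ 2 := by
            rw [hc]; field_simp; norm_num
        _ ≤ n * K * ‖fit X (b - bs)‖ ^ 2 := hsum2.trans hsum
        _ = _ := by rw [hP]; field_simp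
    exact le_of_mul_le_mul_left h1 (by positivity)
  have hm' : (0 : ℝ) < m := by exact_mod_cast Nat.pos_of_ne_zero hm0
  have hKpos : 0 < K := by
    by_contra hK0
    have : K * P ≤ 0 := mul_nonpos_of_nonpos_of_nonneg (not_lt.1 hK0) hP0
    have : 0 < m * c := by positivity
    linarith
  have heta : eta X bs lam xi bs (supp bs) = ENNReal.ofReal c
      * (((supp bs).card : ℝ≥0∞) * ENNReal.ofReal (xi ^ 2) / kappa X xi (supp bs) ^ 2) := by
    rw [eta, l1On_compl_supp, sub_self, norm_zero, mul_zero, zero_pow two_ne_zero, zero_div,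
      add_zero, ENNReal.ofReal_zero, zero_add, ← mul_div_assoc, ← ENNReal.ofReal_natCast,
      ← ENNReal.ofReal_mul (by positivity), ← ENNReal.ofReal_mul hc0.le, hc]
    congr 2
    field_simp
  rw [heta] at hpred
  have h1 : ENNReal.ofReal P < ENNReal.ofReal c * ((m : ℝ≥0∞) / kappaPlus X m (supp bs)) :=
    hpred.trans_lt (ENNReal.mul_lt_mul_right
      (by rw [Ne, ENNReal.ofReal_eq_zero, not_le]; exact hc0) ENNReal.ofReal_ne_top hm)
  rw [← ENNReal.ofReal_toReal htop, ← hK, ← ENNReal.ofReal_natCast,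
    ← ENNReal.ofReal_div_of_pos hKpos, ← ENNReal.ofReal_mul hc0.le,
    ENNReal.ofReal_lt_ofReal_iff (by positivity), ← mul_div_assoc, lt_div_iff₀ hKpos] at h1
  linarith

lemma supp_sub_subset (u v : EuclideanSpace ℝ (Fin p)) : supp (u - v) ⊆ supp u ∪ supp v := by
  intro j hj
  by_contra h
  simp only [supp, Finset.mem_union, Finset.mem_filter, Finset.mem_univ, true_and, not_or,
    not_not] at h
  exact (Finset.mem_filter.1 hj).2 (by simp [h.1, h.2])

theorem deterministic_bounds (X : Matrix (Fin n) (Fin p) ℝ) (y : EuclideanSpace ℝ (Fin n))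
    (bs : EuclideanSpace ℝ (Fin p)) (lam0 xi : ℝ)
    (bhat : EuclideanSpace ℝ (Fin p)) (shat : ℝ)
    (bbar : EuclideanSpace ℝ (Fin p)) (m : ℕ)
    (hlam0 : 0 < lam0) (hxi : 1 < xi) (hs : 0 < residualLevel X y bs)
    (h : IsScaledLasso X y lam0 bhat shat) (hbar : IsRefit X y bhat bbar)
    (hm : ((supp bs).card : ℝ≥0∞) * ENNReal.ofReal (xi ^ 2) / kappa X xi (supp bs) ^ 2
        < (m : ℝ≥0∞) / kappaPlus X m (supp bs))
    (hz : zStar X y bs ≤ (1 - tauStar X y bs lam0 xi ^ 2) * lam0 * (xi - 1) / (xi + 1)) :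
    (supp bhat \ supp bs).card < m ∧
      shat ^ 2 - (sigmaStar X y bs (m - 1) + √(etaStar X bs (shat * lam0) xi)) ^ 2
        ≤ residualLevel X y bbar ^ 2 ∧
      residualLevel X y bbar ^ 2 ≤ shat ^ 2 ∧
      (1 - tauStar X y bs lam0 xi ^ 2) * (shat * lam0) ≤ residualLevel X y bs * lam0 ∧
      kappaMinus X (m - 1) (supp bs) * ENNReal.ofReal (‖bbar - bs‖ ^ 2)
        ≤ ENNReal.ofReal (‖fit X bbar - fit X bs‖ ^ 2 / n) ∧
      ‖fit X bbar - fit X bs‖ ^ 2 / n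
        ≤ (sigmaStar X y bs (m - 1) + 2 * √(etaStar X bs (shat * lam0) xi)) ^ 2 := by
  have hn := pos_of_residualLevel_pos hs
  have hn' : (0 : ℝ) < n := by exact_mod_cast hn
  have hlow := h.one_sub_tauStar_mul_residual_le hlam0 hxi hs hz
  have hup := h.one_sub_tauStar_mul_le hlam0 hxi hs hz
  have hlc := h.lassoCondition hn hlam0.le
  have hnorm := h.norm_sq_eq hn
  have hshat := h.1
  have hlam : 0 < shat * lam0 := by positivity
  have hq : 0 ≤ (xi - 1) / (xi + 1) := div_nonneg (by linarith) (by linarith)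
  have hrho : residualLevel X y bs * zStar X y bs ≤ shat * lam0 * ((xi - 1) / (xi + 1)) := by
    refine (residual_mul_zStar_le hs hz).trans ?_
    gcongr
  have hpred := hlc.norm_sq_le_etaInf hn hxi (noiseBound_zStar hs) hrho hlam
  have hcard := hlc.card_sdiff_lt hn hxi (abs_inner_col_le hs) hrho hlam (hpred _ _) hm
  have hcard' : (supp bhat \ supp bs).card ≤ m - 1 := by omega
  have hH : ‖fit X (bhat - bs)‖ ≤ √(n : ℝ) * √(etaStar X bs (shat * lam0) xi) := by
    have h1 : ‖fit X (bhat - bs)‖ ^ 2 / n ≤ etaStar X bs (shat * lam0) xi :=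
      (ENNReal.ofReal_le_iff_le_toReal (etaInf_ne_top _ _ _ _)).1
        (le_iInf fun w => le_iInf fun T => hpred w T)
    rw [div_le_iff₀ hn'] at h1
    rw [← Real.sqrt_mul hn'.le]
    refine Real.le_sqrt_of_sq_le ?_
    linarith
  have hP : ‖proj X (supp bhat) (y - fit X bs)‖ ≤ √(n : ℝ) * sigmaStar X y bs (m - 1) :=
    norm_proj_le_sigmaStar X y bs hn hcard'
  set K := Submodule.span ℝ (col X '' (supp bhat : Set (Fin p))) with hK
  have hbar' : fit X bbar = K.starProjection y := hbar.fit_eq_proj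
  have hmem : fit X bhat ∈ K := fit_mem_span X subset_rfl
  have hpyth := norm_sub_sq_of_mem K y hmem
  have hdiff : ‖K.starProjection y - fit X bhat‖
      ≤ √(n : ℝ) * (sigmaStar X y bs (m - 1) + √(etaStar X bs (shat * lam0) xi)) := by
    -- Since Xβ̂ lies in the selected span, Py − Xβ̂ = Pε − PX(β̂ − β*): projected noise plus
    -- prediction error.
    have e : K.starProjection y - fit X bhat
        = K.starProjection (y - fit X bs) - K.starProjection (fit X (bhat - bs)) := by
      rw [← map_sub, fit_sub, sub_sub_sub_cancel_right, map_sub]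
      congr 1
      exact (Submodule.starProjection_eq_self_iff.2 hmem).symm
    rw [e, mul_add]
    exact (norm_sub_le _ _).trans (add_le_add hP
      ((Submodule.norm_starProjection_apply_le K _).trans hH))
  have hres := sq_norm_sub_fit (X := X) y bbar hn
  rw [hbar'] at hres
  rw [hnorm, hres] at hpyth
  set A := sigmaStar X y bs (m - 1)
  set E := √(etaStar X bs (shat * lam0) xi)
  have hsq := pow_le_pow_left₀ (norm_nonneg _) hdiff 2
  rw [mul_pow, Real.sq_sqrt hn'.le] at hsq
  refine ⟨hcard, ?_, ?_, ?_, ?_, ?_⟩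
  · have h1 : n * (shat ^ 2 - (A + E) ^ 2) ≤ n * residualLevel X y bbar ^ 2 := by linarith
    exact le_of_mul_le_mul_left h1 hn'
  · have h1 : n * residualLevel X y bbar ^ 2 ≤ n * shat ^ 2 := by
      linarith [sq_nonneg ‖K.starProjection y - fit X bhat‖]
    exact le_of_mul_le_mul_left h1 hn'
  · rw [← mul_assoc]
    exact mul_le_mul_of_nonneg_right hup hlam0.le
  · rw [← fit_sub]
    refine kappaMinus_mul_le X (B := supp bhat ∪ supp bs) Finset.subset_union_right ?_ ?_
    · rwa [Finset.union_sdiff_right]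
    · exact (supp_sub_subset _ _).trans (Finset.union_subset_union_left hbar.1)
  · rw [div_le_iff₀ hn', hbar']
    -- The prediction error of β̂ enters twice, once inside the previous bound and once in passing
    -- from Xβ̂ to Xβ*; hence the factor 2.
    have h1 : ‖K.starProjection y - fit X bs‖ ≤ √(n : ℝ) * (A + 2 * E) := by
      have e : K.starProjection y - fit X bs
          = (K.starProjection y - fit X bhat) + fit X (bhat - bs) := by
        rw [fit_sub]; abel
      rw [e]
      refine (norm_add_le _ _).trans ((add_le_add hdiff hH).trans (le_of_eq (by ring)))
    have h2 := pow_le_pow_left₀ (norm_nonneg _) h1 2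
    rw [mul_pow, Real.sq_sqrt hn'.le] at h2
    linarith

/-! ### Exponential moments of squared Gaussian norms -/

lemma integral_exp_mul_sq_gaussianReal {θ : ℝ} (hθ : θ < 1 / 2) :
    ∫ x, Real.exp (θ * x ^ 2) ∂gaussianReal 0 1 = (√(1 - 2 * θ))⁻¹ := by
  have h1 : ∀ x : ℝ, gaussianPDFReal 0 1 x • Real.exp (θ * x ^ 2)
      = (√(2 * Real.pi))⁻¹ * Real.exp (-(1 / 2 - θ) * x ^ 2) := by
    intro x
    rw [gaussianPDFReal_def, smul_eq_mul, mul_assoc, ← Real.exp_add]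
    congr 2
    · simp
    · push_cast
      ring
  rw [integral_gaussianReal_eq_integral_smul one_ne_zero]
  simp_rw [h1]
  rw [integral_const_mul, integral_gaussian, ← Real.sqrt_inv, ← Real.sqrt_inv, ← Real.sqrt_mul
    (by positivity)]
  congr 1
  have : 1 - 2 * θ ≠ 0 := by linarith
  have h2 : 1 / 2 - θ ≠ 0 := by linarith
  have := Real.pi_ne_zero
  field_simp

section

variable {ι : Type*} [Fintype ι]

lemma integral_exp_mul_sum_sq {θ : ℝ} (hθ : θ < 1 / 2) :
    ∫ x : ι → ℝ, Real.exp (θ * ∑ i, x i ^ 2) ∂Measure.pi (fun _ => gaussianReal 0 1)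
      = (√(1 - 2 * θ))⁻¹ ^ Fintype.card ι := by
  simp_rw [Finset.mul_sum, Real.exp_sum]
  rw [integral_fintype_prod_eq_prod (fun _ x => Real.exp (θ * x ^ 2))]
  simp [integral_exp_mul_sq_gaussianReal hθ]

/-- A non-integrable function has Bochner integral 0, so the nonzero value computed above already
forces integrability. -/
lemma integrable_exp_mul_sum_sq {θ : ℝ} (hθ : θ < 1 / 2) :
    Integrable (fun x : ι → ℝ => Real.exp (θ * ∑ i, x i ^ 2))
      (Measure.pi (fun _ => gaussianReal 0 1)) := by
  refine Integrable.of_integral_ne_zero ?_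
  rw [integral_exp_mul_sum_sq hθ]
  have : 0 < 1 - 2 * θ := by linarith
  positivity

end

section

variable {E : Type*} [NormedAddCommGroup E] [InnerProductSpace ℝ E]

lemma norm_sq_sum_smul_orthonormalBasis {ι : Type*} [Fintype ι] (b : OrthonormalBasis ι ℝ E)
    (x : ι → ℝ) : ‖∑ i, x i • b i‖ ^ 2 = ∑ i, x i ^ 2 := by
  rw [← real_inner_self_eq_norm_sq, b.orthonormal.inner_sum]
  simp [sq]

variable [FiniteDimensional ℝ E] [MeasurableSpace E] [BorelSpace E]

lemma integral_exp_mul_norm_sq_stdGaussian {θ : ℝ} (hθ : θ < 1 / 2) :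
    ∫ x, Real.exp (θ * ‖x‖ ^ 2) ∂stdGaussian E = (√(1 - 2 * θ))⁻¹ ^ Module.finrank ℝ E := by
  rw [stdGaussian, integral_map (Measurable.aemeasurable (by fun_prop))
    (Continuous.aestronglyMeasurable (by fun_prop))]
  simp_rw [norm_sq_sum_smul_orthonormalBasis]
  rw [integral_exp_mul_sum_sq hθ, Fintype.card_fin]

lemma integrable_exp_mul_norm_sq_stdGaussian {θ : ℝ} (hθ : θ < 1 / 2) :
    Integrable (fun x => Real.exp (θ * ‖x‖ ^ 2)) (stdGaussian E) := by
  refine Integrable.of_integral_ne_zero ?_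
  rw [integral_exp_mul_norm_sq_stdGaussian hθ]
  have : 0 < 1 - 2 * θ := by linarith
  positivity

/-- The orthogonal projection of a standard Gaussian vector is standard Gaussian. -/
lemma map_orthogonalProjectionOnto_stdGaussian (K : Submodule ℝ E) :
    (stdGaussian E).map K.orthogonalProjectionOnto = stdGaussian K := by
  have : IsProbabilityMeasure ((stdGaussian E).map K.orthogonalProjectionOnto) :=
    Measure.isProbabilityMeasure_map (Measurable.aemeasurable (by fun_prop))
  refine Measure.ext_of_charFun ?_
  ext t
  rw [charFun_stdGaussian, charFun_apply, integral_map (Measurable.aemeasurable (by fun_prop))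
    (Measurable.aestronglyMeasurable (by fun_prop))]
  simp_rw [Submodule.inner_orthogonalProjectionOnto_eq_of_mem_right]
  rw [← charFun_apply, charFun_stdGaussian]
  rfl

lemma stdGaussian_real_le_norm_starProjection_le (K : Submodule ℝ E) {k : ℕ}
    (hk : Module.finrank ℝ K ≤ k) {θ x : ℝ} (hθ0 : 0 ≤ θ) (hθ : θ < 1 / 2) (hx : 0 ≤ x) :
    (stdGaussian E).real {g | x ≤ ‖K.starProjection g‖}
      ≤ Real.exp (-θ * x ^ 2) * (√(1 - 2 * θ))⁻¹ ^ k := by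
  have h1 : {g : E | x ≤ ‖K.starProjection g‖}
      = K.orthogonalProjectionOnto ⁻¹' {v | x ^ 2 ≤ ‖v‖ ^ 2} := by
    ext g
    simp only [Set.mem_ofPred_eq, Set.mem_preimage]
    rw [pow_le_pow_iff_left₀ hx (norm_nonneg _) two_ne_zero]
    rfl
  have hms : MeasurableSet {v : K | x ^ 2 ≤ ‖v‖ ^ 2} :=
    measurableSet_le (by fun_prop) (by fun_prop)
  rw [h1, ← map_measureReal_apply (by fun_prop) hms, map_orthogonalProjectionOnto_stdGaussian]
  refine (measure_ge_le_exp_mul_mgf (X := fun v : K => ‖v‖ ^ 2) (x ^ 2) hθ0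
    (integrable_exp_mul_norm_sq_stdGaussian hθ)).trans ?_
  rw [mgf, integral_exp_mul_norm_sq_stdGaussian hθ]
  -- For θ ≥ 0 the base is at least 1, so a span of lower dimension only improves the bound.
  refine mul_le_mul_of_nonneg_left (pow_le_pow_right₀ ?_ hk) (Real.exp_pos _).le
  rw [one_le_inv₀ (Real.sqrt_pos.2 (by linarith)), Real.sqrt_le_one]
  linarith

lemma log_le_half_sub_inv {v : ℝ} (hv : 1 ≤ v) : Real.log v ≤ (v - v⁻¹) / 2 := by
  have hv0 : 0 < v := by linarith
  have := Real.self_le_sinh_iff.2 (Real.log_nonneg hv)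
  rwa [Real.sinh_eq, Real.exp_neg, Real.exp_log hv0] at this

/-- Tail bound for the norm of a projected standard Gaussian vector. -/
lemma stdGaussian_real_sqrt_add_le_norm_starProjection (K : Submodule ℝ E) {k : ℕ}
    (hk0 : 0 < k) (hk : Module.finrank ℝ K ≤ k) {t : ℝ} (ht : 0 ≤ t) :
    (stdGaussian E).real {g | √(k : ℝ) + t ≤ ‖K.starProjection g‖}
      ≤ Real.exp (-(t ^ 2 / 2)) * Real.exp (-(t ^ 2 / (2 * (1 + t / √(k : ℝ))))) := by
  have hk' : (0 : ℝ) < k := by exact_mod_cast hk0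
  set r := √(k : ℝ) with hr
  have hr0 : 0 < r := Real.sqrt_pos.2 hk'
  have hr2 : r ^ 2 = k := Real.sq_sqrt hk'.le
  set x := r + t with hx
  have hx0 : 0 < x := by positivity
  have hrx : r ≤ x := by linarith
  have hθ : 1 - 2 * ((1 - (r / x) ^ 2) / 2) = (r / x) ^ 2 := by ring
  -- This θ solves 1 − 2θ = k/x² and minimizes the Chernoff bound in dimension k.
  have h1 := stdGaussian_real_le_norm_starProjection_le K hk (θ := (1 - (r / x) ^ 2) / 2)
    (x := x) (by
      have : (r / x) ^ 2 ≤ 1 := pow_le_one₀ (by positivity) (by rwa [div_le_one hx0])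
      linarith)
    (by
      have : 0 < (r / x) ^ 2 := by positivity
      linarith) hx0.le
  refine h1.trans ?_
  rw [hθ, Real.sqrt_sq (by positivity), inv_div, ← Real.exp_log (show 0 < (x / r) ^ k by positivity),
    ← Real.exp_add, ← Real.exp_add, Real.exp_le_exp, Real.log_pow]
  -- Using log v ≤ (v − 1/v)/2 instead of log v ≤ v − 1 produces the second exponential factor
  -- exactly.
  have h2 := log_le_half_sub_inv (v := x / r) (by rwa [one_le_div hr0])
  have h3 := mul_le_mul_of_nonneg_left h2 hk'.le
  refine (add_le_add_right h3 _).trans (le_of_eq ?_)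
  rw [← hr2, hx]
  field_simp
  ring

end

/-! ### Numerical bounds -/

lemma log_pi_le : Real.log Real.pi ≤ 2 * Real.log 2 - 1 + Real.pi / 4 := by
  have h := Real.log_le_sub_one_of_pos (show 0 < Real.pi / 4 by positivity)
  rw [Real.log_div Real.pi_ne_zero (by norm_num), show (4 : ℝ) = 2 ^ 2 by norm_num,
    Real.log_pow] at h
  push_cast at h
  linarith

lemma log_natCast_le {m : ℕ} (hm : 1 ≤ m) : Real.log m ≤ m / 2 - 1 + Real.log 2 := by
  have hm' : (0 : ℝ) < m := by exact_mod_cast hm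
  have h := Real.log_le_sub_one_of_pos (show (0 : ℝ) < m / 2 by positivity)
  rw [Real.log_div hm'.ne' (by norm_num)] at h
  linarith

lemma choose_mul_le {p m : ℕ} (hm : 1 ≤ m) (hmp : m ≤ p) :
    (p.choose m : ℝ) * (m / (Real.exp 1 * p)) ^ m ≤ (√(2 * Real.pi * m))⁻¹ := by
  have hm' : (0 : ℝ) < m := by exact_mod_cast hm
  have hp' : (0 : ℝ) < p := by exact_mod_cast hm.trans hmp
  have h1 : (p.choose m : ℝ) ≤ (p : ℝ) ^ m / m.factorial := Nat.choose_le_pow_div m p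
  have h2 := Stirling.le_factorial_stirling m
  have h3 : 0 < √(2 * Real.pi * m) * (m / Real.exp 1) ^ m := by positivity
  calc (p.choose m : ℝ) * (m / (Real.exp 1 * p)) ^ m
      ≤ (p : ℝ) ^ m / (√(2 * Real.pi * m) * (m / Real.exp 1) ^ m)
        * (m / (Real.exp 1 * p)) ^ m := by
        gcongr
        exact h1.trans (by gcongr)
    _ = (√(2 * Real.pi * m))⁻¹ := by
        rw [div_pow, div_pow, mul_pow]
        field_simp

/-- The first exponential equals ε(m/(ep))^m, and Stirling's formula bounds its product with the
binomial coefficient by ε/√(2πm). For m < p the second exponential gives the remaining 1/√m. The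
upper bound on ε excludes the trivial range and makes the expression under the root nonnegative. -/
lemma union_bound_numeric {p m k N : ℕ} {eps t : ℝ} (hm : 1 ≤ m) (hmp : m ≤ p) (hmk : m ≤ k)
    (hN : N ≤ p.choose m) (heps : 0 < eps) (heps' : eps < m * √(2 * Real.pi))
    (ht : t = √(2 * m * Real.log (Real.exp 1 * p / m) + 2 * Real.log (1 / eps))) :
    N * (Real.exp (-(t ^ 2 / 2)) * Real.exp (-(t ^ 2 / (2 * (1 + t / √(k : ℝ))))))
      ≤ eps / m / √(2 * Real.pi) := by
  have hm' : (0 : ℝ) < m := by exact_mod_cast hm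
  have hm1 : (1 : ℝ) ≤ m := by exact_mod_cast hm
  have hp' : (0 : ℝ) < p := by exact_mod_cast hm.trans hmp
  have hk' : (0 : ℝ) < k := by exact_mod_cast hm.trans hmk
  have hlp := log_pi_le
  have hpi := Real.pi_lt_d2
  have hl2 := Real.log_two_lt_d9
  have hlogeps : Real.log eps < Real.log m + (Real.log 2 + Real.log Real.pi) / 2 := by
    have := Real.log_lt_log heps heps'
    rwa [Real.log_mul hm'.ne' (by positivity), Real.log_sqrt (by positivity),
      Real.log_mul two_ne_zero Real.pi_ne_zero] at this
  have hlogm : Real.log m ≤ m - 1 := Real.log_le_sub_one_of_pos hm'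
  have hlpm : 0 ≤ Real.log (p / m) := by
    refine Real.log_nonneg ?_
    rw [one_le_div hm']
    exact_mod_cast hmp
  have hD : Real.log (Real.exp 1 * p / m) = 1 + Real.log (p / m) := by
    rw [mul_div_assoc, Real.log_mul (Real.exp_ne_zero _) (by positivity), Real.log_exp]
  set D := 2 * m * Real.log (Real.exp 1 * p / m) + 2 * Real.log (1 / eps) with hDdef
  have hDeq : D = 2 * m + 2 * m * Real.log (p / m) - 2 * Real.log eps := by
    rw [hDdef, hD, one_div, Real.log_inv]
    ring
  have hmlog : 0 ≤ 2 * m * Real.log (p / m) := by positivity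
  have hD0 : 0 ≤ D := by rw [hDeq]; linarith
  have ht0 : 0 ≤ t := ht ▸ Real.sqrt_nonneg _
  have ht2 : t ^ 2 = D := by rw [ht, Real.sq_sqrt hD0]
  have hexp : Real.exp (-(t ^ 2 / 2)) = eps * (m / (Real.exp 1 * p)) ^ m := by
    rw [ht2, ← Real.exp_log (show 0 < eps * (m / (Real.exp 1 * p)) ^ m by positivity),
      Real.log_mul heps.ne' (by positivity), Real.log_pow, hDdef, one_div, Real.log_inv,
      ← inv_div (Real.exp 1 * p) (m : ℝ), Real.log_inv]
    congr 1
    ring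
  have hextra : Real.exp (-(t ^ 2 / (2 * (1 + t / √(k : ℝ))))) ≤ 1 := by
    rw [Real.exp_le_one_iff, neg_nonpos]
    positivity
  have hN' : (N : ℝ) ≤ p.choose m := by exact_mod_cast hN
  -- At m = p the bound t² ≥ m used below can fail, for instance when m = 2. There is then only one
  -- set, and e^m ≥ m√(2π) suffices without Stirling's formula.
  rcases hmp.eq_or_lt with rfl | hlt
  · rw [Nat.choose_self, Nat.cast_one] at hN'
    have hfin : (m / (Real.exp 1 * m)) ^ m ≤ (m * √(2 * Real.pi))⁻¹ := by
      rw [show (m : ℝ) / (Real.exp 1 * m) = (Real.exp 1)⁻¹ by field_simp, inv_pow]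
      refine inv_anti₀ (by positivity) ?_
      rw [← Real.exp_nat_mul, mul_one, ← Real.log_le_iff_le_exp (by positivity),
        Real.log_mul hm'.ne' (by positivity), Real.log_sqrt (by positivity),
        Real.log_mul two_ne_zero Real.pi_ne_zero]
      linarith
    calc N * (Real.exp (-(t ^ 2 / 2)) * Real.exp (-(t ^ 2 / (2 * (1 + t / √(k : ℝ))))))
        ≤ 1 * (Real.exp (-(t ^ 2 / 2)) * 1) := by gcongr
      _ = eps * (m / (Real.exp 1 * m)) ^ m := by rw [one_mul, mul_one, hexp]
      _ ≤ eps * (m * √(2 * Real.pi))⁻¹ := by gcongr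
      _ = _ := by field_simp
  · have hstir := choose_mul_le hm hmp
    have hext : Real.exp (-(t ^ 2 / (2 * (1 + t / √(k : ℝ))))) ≤ (√(m : ℝ))⁻¹ := by
      rcases hm.eq_or_lt with rfl | hm2
      · simpa using hextra
      have hm2' : (2 : ℝ) ≤ m := by exact_mod_cast hm2
      have hlogm2 := log_natCast_le hm
      have hpm : 1 / ((m : ℝ) + 1) ≤ Real.log (p / m) := by
        have h1 : ((m : ℝ) + 1) / m ≤ p / m := by
          gcongr
          exact_mod_cast hlt
        have h2 := Real.log_le_log (by positivity) h1
        have h3 := Real.one_sub_inv_le_log_of_pos (show 0 < ((m : ℝ) + 1) / m by positivity)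
        have h4 : 1 - (((m : ℝ) + 1) / m)⁻¹ = 1 / ((m : ℝ) + 1) := by field_simp; ring
        linarith
      have h43 : 4 / 3 ≤ 2 * m * (1 / ((m : ℝ) + 1)) := by
        rw [mul_one_div, le_div_iff₀ (by positivity)]
        linarith
      have h44 : 2 * m * (1 / ((m : ℝ) + 1)) ≤ 2 * m * Real.log (p / m) := by gcongr
      have hDm : (m : ℝ) ≤ D := by rw [hDeq]; linarith
      have htm : √(m : ℝ) ≤ t := by
        rw [ht]
        exact Real.sqrt_le_sqrt hDm
      have hsm : 0 < √(m : ℝ) := Real.sqrt_pos.2 hm'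
      have hsm2 : √(m : ℝ) ^ 2 = m := Real.sq_sqrt hm'.le
      have htpos : 0 < t := hsm.trans_le htm
      rw [← Real.exp_log (show 0 < (√(m : ℝ))⁻¹ by positivity), Real.exp_le_exp, Real.log_inv,
        neg_le_neg_iff, Real.log_sqrt hm'.le]
      have hw : 1 + t / √(k : ℝ) ≤ 2 * (t / √(m : ℝ)) := by
        have h1 : 1 ≤ t / √(m : ℝ) := by rwa [one_le_div hsm]
        have h2 : t / √(k : ℝ) ≤ t / √(m : ℝ) := by gcongr
        linarith
      calc Real.log m / 2 ≤ m / 4 := by linarith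
        _ = √(m : ℝ) * √(m : ℝ) / 4 := by rw [← sq, hsm2]
        _ ≤ t * √(m : ℝ) / 4 := by gcongr
        _ = t ^ 2 / (2 * (2 * (t / √(m : ℝ)))) := by field_simp; norm_num
        _ ≤ _ := by gcongr
    calc N * (Real.exp (-(t ^ 2 / 2)) * Real.exp (-(t ^ 2 / (2 * (1 + t / √(k : ℝ))))))
        ≤ p.choose m * (Real.exp (-(t ^ 2 / 2)) * (√(m : ℝ))⁻¹) := by gcongr
      _ = eps * (p.choose m * (m / (Real.exp 1 * p)) ^ m) * (√(m : ℝ))⁻¹ := by rw [hexp]; ring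
      _ ≤ eps * (√(2 * Real.pi * m))⁻¹ * (√(m : ℝ))⁻¹ := by gcongr
      _ = _ := by
          rw [Real.sqrt_mul (by positivity)]
          have := Real.mul_self_sqrt hm'.le
          field_simp
          rw [sq, this]

/-! ### The Gaussian model -/

/-- The map g ↦ Xβ + σg is a homeomorphism, so the identity holds for arbitrary sets and no
measurability of the events has to be checked. -/
lemma pr_apply (X : Matrix (Fin n) (Fin p) ℝ) (b : EuclideanSpace ℝ (Fin p)) {s : ℝ}
    (hs : s ≠ 0) (A : Set (EuclideanSpace ℝ (Fin n))) :
    pr X b s A = stdGaussian (EuclideanSpace ℝ (Fin n)) {g | fit X b + s • g ∈ A} :=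
  ((Homeomorph.smulOfNeZero s hs).trans
    (Homeomorph.addLeft (fit X b))).measurableEmbedding.map_apply _ _

lemma card_sigmaStar_index_le (S : Finset (Fin p)) {m : ℕ} (hmp : m ≤ p) :
    Fintype.card {B : Finset (Fin p) // S ⊆ B ∧ (B \ S).card = min m Sᶜ.card}
      ≤ p.choose m := by
  have h1 : Fintype.card {B : Finset (Fin p) // S ⊆ B ∧ (B \ S).card = min m Sᶜ.card}
      ≤ (Finset.powersetCard (min m Sᶜ.card) Sᶜ).card := by
    rw [Fintype.card_subtype]
    refine Finset.card_le_card_of_injOn (fun B => B \ S) (fun B hB => ?_) fun B hB C hC h => ?_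
    · exact Finset.mem_coe.2 (Finset.mem_powersetCard.2
        ⟨fun j hj => by simpa using (Finset.mem_sdiff.1 hj).2, (Finset.mem_filter.1 hB).2.2⟩)
    · rw [← Finset.sdiff_union_of_subset (Finset.mem_filter.1 hB).2.1,
        ← Finset.sdiff_union_of_subset (Finset.mem_filter.1 hC).2.1]
      exact congrArg (· ∪ S) h
  refine h1.trans ?_
  rw [Finset.card_powersetCard]
  rcases le_total m Sᶜ.card with h | h
  · rw [min_eq_left h]
    exact Nat.choose_le_choose m (by simpa using Finset.card_le_univ Sᶜ)
  · rw [min_eq_right h, Nat.choose_self]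
    exact Nat.choose_pos hmp

lemma finrank_span_col_le (X : Matrix (Fin n) (Fin p) ℝ) (B : Finset (Fin p)) :
    Module.finrank ℝ (Submodule.span ℝ (col X '' (B : Set (Fin p)))) ≤ B.card := by
  classical
  rw [← Finset.coe_image]
  exact (finrank_span_finset_le_card _).trans Finset.card_image_le

theorem pr_sigmaStar_le (X : Matrix (Fin n) (Fin p) ℝ) (bs : EuclideanSpace ℝ (Fin p))
    (sigma eps : ℝ) (m : ℕ) (hsigma : 0 < sigma) (heps : 0 < eps) (hm : 1 ≤ m) (hmp : m ≤ p) :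
    pr X bs sigma
          {y | √((m : ℝ) + (supp bs).card)
              + √(2 * m * Real.log (Real.exp 1 * p / m) + 2 * Real.log (1 / eps))
            ≤ sigmaStar X y bs m * √(n : ℝ) / sigma}
        ≤ ENNReal.ofReal (eps / m / √(2 * Real.pi)) := by
  have hm' : (0 : ℝ) < m := by exact_mod_cast hm
  rw [pr_apply X bs hsigma.ne']
  rcases le_or_gt (m * √(2 * Real.pi)) eps with heps' | heps'
  · refine prob_le_one.trans ?_
    rw [← ENNReal.ofReal_one]
    refine ENNReal.ofReal_le_ofReal ?_
    rw [div_div, one_le_div (by positivity)]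
    exact heps'
  set t := √(2 * m * Real.log (Real.exp 1 * p / m) + 2 * Real.log (1 / eps)) with ht
  set k := m + (supp bs).card with hk
  have hk0 : 0 < k := by omega
  rw [show (m : ℝ) + (supp bs).card = (k : ℝ) by rw [hk]; push_cast; ring]
  set J := {B : Finset (Fin p) // supp bs ⊆ B ∧ (B \ supp bs).card = min m (supp bs)ᶜ.card}
  have hsub : {g | fit X bs + sigma • g ∈ {y | √(k : ℝ) + t
      ≤ sigmaStar X y bs m * √(n : ℝ) / sigma}}
      ⊆ ⋃ B : J, {g : EuclideanSpace ℝ (Fin n) | √(k : ℝ) + t ≤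
        ‖(Submodule.span ℝ (col X '' (B.1 : Set (Fin p)))).starProjection g‖} := by
    intro g hg
    have hpos : 0 < √(k : ℝ) + t :=
      add_pos_of_pos_of_nonneg (Real.sqrt_pos.2 (by exact_mod_cast hk0)) (Real.sqrt_nonneg _)
    simp only [Set.mem_ofPred_eq, sigmaStar, add_sub_cancel_left] at hg
    rcases Nat.eq_zero_or_pos n with hn0 | hn
    · subst hn0
      rw [Nat.cast_zero, Real.sqrt_zero, mul_zero, zero_div] at hg
      exact absurd hg (not_le.2 hpos)
    have hn' : 0 < √(n : ℝ) := Real.sqrt_pos.2 (by exact_mod_cast hn)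
    rcases isEmpty_or_nonempty J with hJ | hJ
    · rw [Real.iSup_of_isEmpty, zero_mul, zero_div] at hg
      exact absurd hg (not_le.2 hpos)
    obtain ⟨B, hB⟩ := exists_eq_ciSup_of_finite
      (f := fun B : J => ‖proj X B.1 (sigma • g)‖ / √(n : ℝ))
    rw [← hB, div_mul_cancel₀ _ hn'.ne', proj, map_smul, norm_smul,
      Real.norm_of_nonneg hsigma.le, mul_div_cancel_left₀ _ hsigma.ne'] at hg
    exact Set.mem_iUnion.2 ⟨B, hg⟩
  have hB : ∀ B : J, stdGaussian (EuclideanSpace ℝ (Fin n)) {g | √(k : ℝ) + t ≤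
      ‖(Submodule.span ℝ (col X '' (B.1 : Set (Fin p)))).starProjection g‖}
      ≤ ENNReal.ofReal (Real.exp (-(t ^ 2 / 2))
        * Real.exp (-(t ^ 2 / (2 * (1 + t / √(k : ℝ)))))) := by
    intro B
    rw [← ofReal_measureReal]
    refine ENNReal.ofReal_le_ofReal (stdGaussian_real_sqrt_add_le_norm_starProjection _ hk0
      ((finrank_span_col_le X B.1).trans ?_) (Real.sqrt_nonneg _))
    have h1 := Finset.card_sdiff_add_card_eq_card B.2.1
    have h2 := B.2.2
    have h3 := min_le_left m (supp bs)ᶜ.card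
    omega
  calc stdGaussian (EuclideanSpace ℝ (Fin n)) _ ≤ _ := measure_mono hsub
    _ ≤ ∑ B : J, stdGaussian (EuclideanSpace ℝ (Fin n)) {g | √(k : ℝ) + t ≤
        ‖(Submodule.span ℝ (col X '' (B.1 : Set (Fin p)))).starProjection g‖} :=
        measure_iUnion_fintype_le _ _
    _ ≤ ∑ _B : J, ENNReal.ofReal (Real.exp (-(t ^ 2 / 2))
        * Real.exp (-(t ^ 2 / (2 * (1 + t / √(k : ℝ)))))) := Finset.sum_le_sum fun B _ => hB B
    _ = ENNReal.ofReal (Fintype.card J * (Real.exp (-(t ^ 2 / 2))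
        * Real.exp (-(t ^ 2 / (2 * (1 + t / √(k : ℝ))))))) := by
        rw [Finset.sum_const, Finset.card_univ, nsmul_eq_mul,
          ENNReal.ofReal_mul (Nat.cast_nonneg _), ENNReal.ofReal_natCast]
    _ ≤ _ := ENNReal.ofReal_le_ofReal (union_bound_numeric hm hmp (by omega)
        (card_sigmaStar_index_le _ hmp) heps heps' ht)

/-! ### Spherical caps -/

/-- The exponential tilt turns the N(0,1) density into √v times the N(0,v) density. -/
lemma integral_sq_mul_exp_gaussianReal {v : NNReal} (hv : v ≠ 0) :
    ∫ x, x ^ 2 * Real.exp ((1 - (v : ℝ)⁻¹) / 2 * x ^ 2) ∂gaussianReal 0 1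
      = v * √(v : ℝ) := by
  have hv' : (0 : ℝ) < v := by exact_mod_cast pos_iff_ne_zero.2 hv
  have h1 : ∫ x, x ^ 2 ∂gaussianReal 0 v = v := by
    rw [← variance_of_integral_eq_zero (X := fun x => x) (by fun_prop) (by simp),
      variance_fun_id_gaussianReal]
  rw [integral_gaussianReal_eq_integral_smul hv] at h1
  rw [integral_gaussianReal_eq_integral_smul one_ne_zero,
    show (v : ℝ) * √(v : ℝ) = √(v : ℝ) * ∫ x, gaussianPDFReal 0 v x • x ^ 2 by
      rw [h1, mul_comm], ← integral_const_mul]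
  refine integral_congr_ae (Filter.Eventually.of_forall fun x => ?_)
  simp only [gaussianPDFReal_def, smul_eq_mul, sub_zero, NNReal.coe_one, mul_one]
  rw [Real.sqrt_mul (by positivity) (v : ℝ)]
  have h2 : Real.exp (-x ^ 2 / (2 * v)) = Real.exp (-x ^ 2 / 2)
      * Real.exp ((1 - (v : ℝ)⁻¹) / 2 * x ^ 2) := by
    rw [← Real.exp_add]
    congr 1
    field_simp
    ring
  rw [h2]
  have := Real.sqrt_pos.2 hv'
  field_simp

section

variable {ι : Type*} [Fintype ι] [DecidableEq ι]

lemma one_sub_two_mul_half (v : ℝ) : 1 - 2 * ((1 - v⁻¹) / 2) = v⁻¹ := by ring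

lemma integral_sq_mul_exp_pi {v : NNReal} (hv : v ≠ 0) (i : ι) :
    ∫ x : ι → ℝ, x i ^ 2 * Real.exp ((1 - (v : ℝ)⁻¹) / 2 * ∑ j, x j ^ 2)
      ∂Measure.pi (fun _ => gaussianReal 0 1) = v * √(v : ℝ) ^ Fintype.card ι := by
  have hv' : (0 : ℝ) < v := by exact_mod_cast pos_iff_ne_zero.2 hv
  set θ := (1 - (v : ℝ)⁻¹) / 2 with hθ
  have hθ2 : θ < 1 / 2 := by
    have : 0 < (v : ℝ)⁻¹ := by positivity
    rw [hθ]
    linarith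
  have h1 : ∀ x : ι → ℝ, x i ^ 2 * Real.exp (θ * ∑ j, x j ^ 2)
      = ∏ j, (if j = i then x j ^ 2 else 1) * Real.exp (θ * x j ^ 2) := by
    intro x
    rw [Finset.prod_mul_distrib, Finset.prod_ite_eq' Finset.univ i, if_pos (Finset.mem_univ i),
      Finset.mul_sum, Real.exp_sum]
  simp_rw [h1]
  rw [integral_fintype_prod_eq_prod
    (fun j x => (if j = i then x ^ 2 else 1) * Real.exp (θ * x ^ 2))]
  have h2 : ∀ j, ∫ x, (if j = i then x ^ 2 else 1) * Real.exp (θ * x ^ 2) ∂gaussianReal 0 1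
      = (if j = i then (v : ℝ) else 1) * √(v : ℝ) := by
    intro j
    by_cases hj : j = i
    · simp only [hj, if_true]
      exact integral_sq_mul_exp_gaussianReal hv
    · simp only [hj, if_false, one_mul]
      rw [integral_exp_mul_sq_gaussianReal hθ2, hθ, one_sub_two_mul_half, Real.sqrt_inv, inv_inv]
  simp_rw [h2]
  rw [Finset.prod_mul_distrib, Finset.prod_ite_eq' Finset.univ i, if_pos (Finset.mem_univ i),
    Finset.prod_const, Finset.card_univ]

/-- The first moment of the norm of a Gaussian vector against an exponential tilt. -/
lemma lintegral_sqrt_mul_exp_pi_le [Nonempty ι] {v : NNReal} (hv : v ≠ 0) :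
    ∫⁻ x : ι → ℝ, ENNReal.ofReal (√(∑ j, x j ^ 2)
        * Real.exp ((1 - (v : ℝ)⁻¹) / 2 * ∑ j, x j ^ 2)) ∂Measure.pi (fun _ => gaussianReal 0 1)
      ≤ ENNReal.ofReal (√(Fintype.card ι : ℝ) * √(v : ℝ) ^ (Fintype.card ι + 1)) := by
  have hv' : (0 : ℝ) < v := by exact_mod_cast pos_iff_ne_zero.2 hv
  set d := Fintype.card ι with hd
  have hd' : (0 : ℝ) < d := by exact_mod_cast Fintype.card_pos
  set θ := (1 - (v : ℝ)⁻¹) / 2 with hθ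
  have hθ2 : θ < 1 / 2 := by
    have : 0 < (v : ℝ)⁻¹ := by positivity
    rw [hθ]
    linarith
  -- K² is the mean squared norm under the tilted law. With this K the bound √S ≤ S/(2K) + K/2
  -- reproduces the Jensen estimate of the mean norm.
  set K := √(d * v : ℝ) with hK
  have hK0 : 0 < K := Real.sqrt_pos.2 (by positivity)
  have hK2 : K ^ 2 = d * v := Real.sq_sqrt (by positivity)
  have hint1 : Integrable (fun x : ι → ℝ => ∑ i, x i ^ 2 * Real.exp (θ * ∑ j, x j ^ 2))
      (Measure.pi (fun _ => gaussianReal 0 1)) := by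
    refine integrable_finsetSum _ fun i _ => Integrable.of_integral_ne_zero ?_
    rw [integral_sq_mul_exp_pi hv]
    positivity
  have hint2 : Integrable (fun x : ι → ℝ => Real.exp (θ * ∑ j, x j ^ 2))
      (Measure.pi (fun _ => gaussianReal 0 1)) := integrable_exp_mul_sum_sq hθ2
  have hint : Integrable (fun x : ι → ℝ => (2 * K)⁻¹
      * ∑ i, x i ^ 2 * Real.exp (θ * ∑ j, x j ^ 2) + K / 2 * Real.exp (θ * ∑ j, x j ^ 2))
      (Measure.pi (fun _ => gaussianReal 0 1)) := (hint1.const_mul _).add (hint2.const_mul _)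
  have hval : ∫ x : ι → ℝ, (2 * K)⁻¹
      * ∑ i, x i ^ 2 * Real.exp (θ * ∑ j, x j ^ 2) + K / 2 * Real.exp (θ * ∑ j, x j ^ 2)
      ∂Measure.pi (fun _ => gaussianReal 0 1) = √(d : ℝ) * √(v : ℝ) ^ (d + 1) := by
    rw [integral_add (hint1.const_mul _) (hint2.const_mul _), integral_const_mul,
      integral_const_mul, integral_finsetSum]
    · simp_rw [hθ, integral_sq_mul_exp_pi hv]
      rw [integral_exp_mul_sum_sq (hθ ▸ hθ2), one_sub_two_mul_half, Real.sqrt_inv, inv_inv,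
        Finset.sum_const, Finset.card_univ, ← hd, nsmul_eq_mul, ← mul_assoc (d : ℝ), ← hK2,
        show √(d : ℝ) * √(v : ℝ) ^ (d + 1) = K * √(v : ℝ) ^ d by
          rw [hK, Real.sqrt_mul hd'.le]; ring]
      field_simp
      ring
    · intro i _
      refine Integrable.of_integral_ne_zero ?_
      rw [integral_sq_mul_exp_pi hv]
      positivity
  rw [← hval, ofReal_integral_eq_lintegral_ofReal hint]
  · refine lintegral_mono fun x => ENNReal.ofReal_le_ofReal ?_
    set S := ∑ j, x j ^ 2 with hS
    have hS0 : 0 ≤ S := Finset.sum_nonneg fun _ _ => sq_nonneg _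
    rw [← Finset.sum_mul, ← hS, ← mul_assoc, ← add_mul]
    refine mul_le_mul_of_nonneg_right ?_ (Real.exp_pos _).le
    have h1 := Real.sq_sqrt hS0
    have h2 : (2 * K)⁻¹ * S + K / 2 - √S = (√S - K) ^ 2 / (2 * K) := by
      rw [sub_sq, h1]
      field_simp
      ring
    have h3 : 0 ≤ (√S - K) ^ 2 / (2 * K) := by positivity
    linarith
  · exact Filter.Eventually.of_forall fun x => by
      simp only [Pi.zero_apply]
      have : 0 ≤ ∑ i, x i ^ 2 * Real.exp (θ * ∑ j, x j ^ 2) :=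
        Finset.sum_nonneg fun _ _ => by positivity
      positivity

end

/-- The substitution x = rs moves the radius r from the limit of integration into the integrand, so
that Fubini can then average over r. -/
lemma gaussianReal_lt_abs_eq {c r : ℝ} (hc : 0 < c) (hr : 0 < r) :
    gaussianReal 0 1 {x | c * r < |x|} = ∫⁻ s in Set.Ioi c,
      ENNReal.ofReal (√(2 / Real.pi) * (r * Real.exp (-s ^ 2 / 2 * r ^ 2))) := by
  have hIoi : gaussianReal 0 1 (Set.Ioi (r * c)) = ∫⁻ s in Set.Ioi c,
      ENNReal.ofReal ((√(2 * Real.pi))⁻¹ * (r * Real.exp (-s ^ 2 / 2 * r ^ 2))) := by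
    rw [gaussianReal_apply 0 one_ne_zero, ← Set.image_mul_left_Ioi hr c,
      lintegral_image_eq_lintegral_abs_deriv_mul measurableSet_Ioi (f' := fun _ => r)
        (fun x _ => by simpa using ((hasDerivAt_id x).const_mul r).hasDerivWithinAt)
        (mul_right_injective₀ hr.ne').injOn]
    refine lintegral_congr fun s => ?_
    rw [gaussianPDF_def, ← ENNReal.ofReal_mul (abs_nonneg _), abs_of_pos hr, gaussianPDFReal_def]
    congr 1
    simp only [NNReal.coe_one, mul_one, sub_zero]
    rw [show -(r * s) ^ 2 / 2 = -s ^ 2 / 2 * r ^ 2 by ring]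
    ring
  have hIio : gaussianReal 0 1 (Set.Iio (-(r * c))) = gaussianReal 0 1 (Set.Ioi (r * c)) := by
    have h := gaussianReal_map_neg (μ := 0) (v := 1)
    rw [neg_zero] at h
    conv_lhs => rw [← h]
    rw [Measure.map_apply (by fun_prop) measurableSet_Iio]
    congr 1
    ext x
    simp
  have hset : {x : ℝ | c * r < |x|} = Set.Ioi (r * c) ∪ Set.Iio (-(r * c)) := by
    ext x
    simp only [Set.mem_ofPred_eq, Set.mem_union, Set.mem_Ioi, Set.mem_Iio, lt_abs, mul_comm r c]
    constructor <;> rintro (h | h)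
    · exact Or.inl h
    · exact Or.inr (by linarith)
    · exact Or.inl h
    · exact Or.inr (by linarith)
  rw [hset, measure_union _ measurableSet_Iio, hIio, ← two_mul, hIoi,
    ← lintegral_const_mul _ (by fun_prop)]
  · refine lintegral_congr fun s => ?_
    rw [show (2 : ℝ≥0∞) = ENNReal.ofReal 2 by simp, ← ENNReal.ofReal_mul zero_le_two]
    congr 1
    rw [← mul_assoc]
    congr 1
    rw [Real.sqrt_div zero_le_two, Real.sqrt_mul zero_le_two]
    have h2 : √(2 : ℝ) * √2 = 2 := Real.mul_self_sqrt zero_le_two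
    have h3 : 0 < √(2 : ℝ) := by positivity
    field_simp
    rw [sq, h2]
  · rw [Set.disjoint_left]
    intro x hx hx'
    rw [Set.mem_Ioi] at hx
    rw [Set.mem_Iio] at hx'
    have : 0 < r * c := by positivity
    linarith

/-- Inserting the factor s/c ≥ 1 makes the integrand an exact derivative. -/
lemma lintegral_Ioi_inv_sqrt_pow_le {c A : ℝ} {k : ℕ} (hc : 0 < c) (hA : 0 ≤ A) (hk : 0 < k) :
    ∫⁻ s in Set.Ioi c, ENNReal.ofReal (A * (√(1 + s ^ 2))⁻¹ ^ (k + 2))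
      ≤ ENNReal.ofReal (A / (c * k) * (√(1 + c ^ 2))⁻¹ ^ k) := by
  have hk' : (0 : ℝ) < k := by exact_mod_cast hk
  set g : ℝ → ℝ := fun s => -(A / (c * k) * (√(1 + s ^ 2))⁻¹ ^ k) with hg
  set g' : ℝ → ℝ := fun s => s / c * (A * (√(1 + s ^ 2))⁻¹ ^ (k + 2)) with hg'
  have hderiv : ∀ s ∈ Set.Ici c, HasDerivAt g (g' s) s := by
    intro s _
    have hpos : 0 < 1 + s ^ 2 := by positivity
    have h1 : HasDerivAt (fun s : ℝ => 1 + s ^ 2) (2 * s) s := by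
      simpa using (hasDerivAt_pow 2 s).const_add 1
    have h2 := (((h1.sqrt hpos.ne').inv (Real.sqrt_pos.2 hpos).ne').pow k).const_mul (A / (c * k))
    have h3 : HasDerivAt g _ s := h2.neg
    refine h3.congr_deriv ?_
    rw [hg']
    have hq := Real.sqrt_pos.2 hpos
    obtain ⟨j, rfl⟩ : ∃ j, k = j + 1 := ⟨k - 1, by omega⟩
    simp only [Nat.add_sub_cancel]
    push_cast
    push_cast at hk'
    simp only [Pi.inv_apply, inv_pow]
    field_simp
    ring
  have hnn : ∀ s ∈ Set.Ioi c, 0 ≤ g' s := by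
    intro s hs
    have : 0 < s := hc.trans hs
    positivity
  have hlim : Filter.Tendsto g Filter.atTop (nhds 0) := by
    have h1 : Filter.Tendsto (fun s : ℝ => 1 + s ^ 2) Filter.atTop Filter.atTop :=
      Filter.tendsto_atTop_add_const_left _ _ (Filter.tendsto_pow_atTop two_ne_zero)
    have h2 := ((tendsto_inv_atTop_zero.comp (Real.tendsto_sqrt_atTop.comp h1)).pow k).const_mul
      (A / (c * k))
    rw [zero_pow hk.ne', mul_zero] at h2
    have h3 := h2.neg
    rw [neg_zero] at h3
    exact h3
  have hint := integrableOn_Ioi_deriv_of_nonneg' hderiv hnn hlim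
  have hval := integral_Ioi_of_hasDerivAt_of_nonneg' hderiv hnn hlim
  calc ∫⁻ s in Set.Ioi c, ENNReal.ofReal (A * (√(1 + s ^ 2))⁻¹ ^ (k + 2))
      ≤ ∫⁻ s in Set.Ioi c, ENNReal.ofReal (g' s) := by
        refine setLIntegral_mono' measurableSet_Ioi fun s hs => ENNReal.ofReal_le_ofReal ?_
        refine le_mul_of_one_le_left (by positivity) ?_
        rw [one_le_div hc]
        exact (Set.mem_Ioi.1 hs).le
    _ = ENNReal.ofReal (0 - g c) := by
        rw [← hval, ofReal_integral_eq_lintegral_ofReal hint]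
        exact (ae_restrict_iff' measurableSet_Ioi).2 (Filter.Eventually.of_forall hnn)
    _ = _ := by rw [hg, zero_sub, neg_neg]

/-- Conditioning on the orthogonal component and exchanging integrals leaves a tilted mean norm in
dimension k + 1, with v = 1/(1+s²), to be integrated over s > c. The null event of a zero orthogonal
component is discarded because the substitution needs a positive radius. -/
lemma gaussian_prod_pi_cone_le {c : ℝ} {k : ℕ} (hc : 0 < c) (hk : 0 < k) :
    (gaussianReal 0 1).prod (Measure.pi (fun _ : Fin (k + 1) => gaussianReal 0 1))
        {x | c * √(∑ j, x.2 j ^ 2) < |x.1|}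
      ≤ ENNReal.ofReal (√(2 / Real.pi) * √((k + 1 : ℕ) : ℝ) / (c * k)
        * (√(1 + c ^ 2))⁻¹ ^ k) := by
  have hms : MeasurableSet {x : ℝ × (Fin (k + 1) → ℝ) | c * √(∑ j, x.2 j ^ 2) < |x.1|} :=
    measurableSet_lt (by fun_prop) (by fun_prop)
  have hatom : NullSingletonClass (gaussianReal 0 1) := nullSingletonClass_gaussianReal one_ne_zero
  rw [Measure.prod_apply_symm hms]
  have hae : ∀ᵐ z ∂Measure.pi (fun _ : Fin (k + 1) => gaussianReal 0 1), z ≠ 0 := by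
    have := Measure.pi_nullSingletonClass'
      (μ := fun _ : Fin (k + 1) => gaussianReal 0 1)
    rw [ae_iff]
    simp
  have hstep : ∫⁻ z, gaussianReal 0 1 ((fun x => (x, z)) ⁻¹'
        {x : ℝ × (Fin (k + 1) → ℝ) | c * √(∑ j, x.2 j ^ 2) < |x.1|})
        ∂Measure.pi (fun _ : Fin (k + 1) => gaussianReal 0 1)
      = ∫⁻ z, (∫⁻ s in Set.Ioi c, ENNReal.ofReal (√(2 / Real.pi)
        * (√(∑ j, z j ^ 2) * Real.exp (-s ^ 2 / 2 * ∑ j, z j ^ 2))))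
        ∂Measure.pi (fun _ : Fin (k + 1) => gaussianReal 0 1) := by
    refine lintegral_congr_ae ?_
    filter_upwards [hae] with z hz
    have hS : 0 < ∑ j, z j ^ 2 := by
      refine lt_of_le_of_ne (Finset.sum_nonneg fun _ _ => sq_nonneg _) fun h => hz ?_
      ext j
      have := (Finset.sum_eq_zero_iff_of_nonneg (fun _ _ => sq_nonneg _)).1 h.symm j
        (Finset.mem_univ j)
      simpa using this
    have := gaussianReal_lt_abs_eq hc (Real.sqrt_pos.2 hS)
    rw [Real.sq_sqrt hS.le] at this
    exact this
  rw [hstep, lintegral_lintegral_swap (by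
    refine Measurable.aemeasurable ?_
    unfold Function.uncurry
    fun_prop)]
  refine le_trans (lintegral_mono fun s => ?_)
    (lintegral_Ioi_inv_sqrt_pow_le (A := √(2 / Real.pi) * √((k + 1 : ℕ) : ℝ)) hc
      (by positivity) hk)
  have hpos : 0 < 1 + s ^ 2 := by positivity
  set v : NNReal := ⟨(1 + s ^ 2)⁻¹, by positivity⟩ with hv
  have hv0 : v ≠ 0 := by
    rw [Ne, ← NNReal.coe_eq_zero]
    exact (inv_pos.2 hpos).ne'
  have hvc : (v : ℝ) = (1 + s ^ 2)⁻¹ := rfl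
  have h1 := lintegral_sqrt_mul_exp_pi_le (ι := Fin (k + 1)) hv0
  rw [hvc, inv_inv, Fintype.card_fin, Real.sqrt_inv, show (1 - (1 + s ^ 2)) / 2 = -s ^ 2 / 2 by ring]
    at h1
  simp_rw [ENNReal.ofReal_mul (Real.sqrt_nonneg (2 / Real.pi))]
  rw [lintegral_const_mul _ (by fun_prop), mul_assoc,
    ENNReal.ofReal_mul (Real.sqrt_nonneg (2 / Real.pi))]
  exact mul_le_mul_right h1 _

/-- The probability that a standard Gaussian vector lies in a double cone about a unit vector. -/
lemma stdGaussian_cone_le {k : ℕ} (hk : 0 < k) {u : EuclideanSpace ℝ (Fin (k + 2))}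
    (hu : ‖u‖ = 1) {a : ℝ} (ha0 : 0 < a) (ha1 : a < 1) :
    stdGaussian (EuclideanSpace ℝ (Fin (k + 2))) {g | a * ‖g‖ < |inner ℝ u g|}
      ≤ ENNReal.ofReal (√(2 / Real.pi) * √((k + 1 : ℕ) : ℝ) / (a * k)
        * √(1 - a ^ 2) ^ (k + 1)) := by
  have ha2 : 0 < 1 - a ^ 2 := by nlinarith
  obtain ⟨b, hb⟩ := Orthonormal.exists_orthonormalBasis_extension_of_card_eq
    (𝕜 := ℝ) (E := EuclideanSpace ℝ (Fin (k + 2))) (ι := Fin (k + 2)) (by simp)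
    (v := fun _ => u) (s := {0}) (by
      rw [orthonormal_iff_ite]
      rintro ⟨i, hi⟩ ⟨j, hj⟩
      rw [Set.mem_singleton_iff] at hi hj
      subst hi hj
      simp [hu])
  have hb0 : b 0 = u := hb 0 rfl
  have hms : MeasurableSet {g : EuclideanSpace ℝ (Fin (k + 2)) | a * ‖g‖ < |inner ℝ u g|} :=
    measurableSet_lt (by fun_prop) (by fun_prop)
  set q := √(1 - a ^ 2) with hq
  have hq0 : 0 < q := Real.sqrt_pos.2 ha2
  have hq2 : q ^ 2 = 1 - a ^ 2 := Real.sq_sqrt ha2.le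
  have hc : 0 < a / q := by positivity
  have hmp := measurePreserving_piFinSuccAbove (fun _ : Fin (k + 2) => gaussianReal 0 1) 0
  have hms2 : MeasurableSet {x : ℝ × (Fin (k + 1) → ℝ) | a / q * √(∑ j, x.2 j ^ 2) < |x.1|} :=
    measurableSet_lt (by fun_prop) (by fun_prop)
  have h1 := gaussian_prod_pi_cone_le hc hk
  rw [← hmp.measure_preimage hms2.nullMeasurableSet] at h1
  rw [stdGaussian_eq_map_pi_orthonormalBasis b, Measure.map_apply (by fun_prop) hms]
  refine (measure_mono ?_).trans (h1.trans (ENNReal.ofReal_le_ofReal (le_of_eq ?_)))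
  · intro x hx
    simp only [Set.mem_preimage, Set.mem_ofPred_eq] at hx
    have hinner : inner ℝ u (∑ i, x i • b i) = x 0 := by
      rw [← hb0, b.orthonormal.inner_right_fintype]
    have hnorm := norm_sq_sum_smul_orthonormalBasis b x
    rw [Fin.sum_univ_succ (fun i => x i ^ 2)] at hnorm
    rw [hinner] at hx
    change a / q * √(∑ j, x (Fin.succAbove 0 j) ^ 2) < |x 0|
    simp only [Fin.succAbove_zero]
    set S := ∑ j : Fin (k + 1), x j.succ ^ 2 with hS
    have hS0 : 0 ≤ S := Finset.sum_nonneg fun _ _ => sq_nonneg _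
    have h2 := pow_lt_pow_left₀ hx (by positivity) two_ne_zero
    rw [mul_pow, hnorm, sq_abs] at h2
    refine lt_of_pow_lt_pow_left₀ 2 (abs_nonneg _) ?_
    rw [mul_pow, Real.sq_sqrt hS0, sq_abs, div_pow, div_mul_eq_mul_div, div_lt_iff₀ (by positivity),
      hq2]
    linarith
  · have h3 : √(1 + (a / q) ^ 2) = q⁻¹ := by
      rw [show 1 + (a / q) ^ 2 = (q⁻¹) ^ 2 by
        rw [div_pow, inv_pow]
        field_simp
        rw [hq2]
        ring]
      exact Real.sqrt_sq (by positivity)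
    rw [h3, inv_inv, pow_succ]
    field_simp

/-! ### The maximal noise correlation -/

lemma log_one_sub_le {x : ℝ} (hx0 : 0 ≤ x) (hx1 : x < 1) :
    Real.log (1 - x) ≤ -x - x ^ 2 / 2 := by
  have h := Real.hasSum_pow_div_log_of_abs_lt_one (x := x) (by rwa [abs_of_nonneg hx0])
  have h1 := sum_le_hasSum (Finset.range 2) (fun i _ => by positivity) h
  norm_num [Finset.sum_range_succ] at h1
  linarith

/-- Here n = k + 2 and a² = 2L/n. The quadratic term of log(1 − x) compensates for the exponent
(n−1)/2 in place of n/2, and L ≥ 2 is enough for this. The prefactor is at most (1 + 2/k)/√(πL), and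
k > L ≥ 2/δ. -/
lemma cap_numeric {k : ℕ} {L δ : ℝ} (hL2 : 2 ≤ L) (hLδ : 2 / δ ≤ L) (hδ : 0 < δ) (hLk : L < k)
    (ha : 2 * L / (k + 2 : ℕ) < 1) :
    √(2 / Real.pi) * √((k + 1 : ℕ) : ℝ) / (√(2 * L / (k + 2 : ℕ)) * k)
        * √(1 - √(2 * L / (k + 2 : ℕ)) ^ 2) ^ (k + 1)
      ≤ (1 + δ) * Real.exp (-L) / √(Real.pi * L) := by
  have hL0 : 0 < L := by linarith
  have hk0 : (0 : ℝ) < k := by linarith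
  rw [Real.sq_sqrt (by positivity)]
  have hexp : √(1 - 2 * L / (k + 2 : ℕ)) ^ (k + 1) ≤ Real.exp (-L) := by
    have h0 : 0 < 1 - 2 * L / (k + 2 : ℕ) := by linarith
    rw [← Real.log_le_iff_le_exp (by positivity), Real.log_pow, Real.log_sqrt h0.le]
    have h1 := log_one_sub_le (x := 2 * L / (k + 2 : ℕ)) (by positivity) ha
    have h2 : ((k + 1 : ℕ) : ℝ) * (Real.log (1 - 2 * L / (k + 2 : ℕ)) / 2)
        ≤ ((k + 1 : ℕ) : ℝ)
          * ((-(2 * L / (k + 2 : ℕ)) - (2 * L / (k + 2 : ℕ)) ^ 2 / 2) / 2) := by gcongr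
    refine h2.trans ?_
    push_cast
    have h3 : ((k : ℝ) + 1) * ((-(2 * L / (k + 2)) - (2 * L / (k + 2)) ^ 2 / 2) / 2) + L
        = - (L * ((k + 1) * L - (k + 2))) / (k + 2) ^ 2 := by
      field_simp
      ring
    have h4 : 0 ≤ L * ((k + 1) * L - (k + 2)) := mul_nonneg hL0.le (by nlinarith)
    have h5 : - (L * ((k + 1) * L - (k + 2))) / ((k : ℝ) + 2) ^ 2 ≤ 0 :=
      div_nonpos_of_nonpos_of_nonneg (by linarith) (by positivity)
    linarith
  have hfac : √(2 / Real.pi) * √((k + 1 : ℕ) : ℝ) / (√(2 * L / (k + 2 : ℕ)) * k)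
      ≤ (1 + δ) / √(Real.pi * L) := by
    rw [← Real.sqrt_mul (by positivity), ← div_div, ← Real.sqrt_div (by positivity),
      div_le_div_iff₀ hk0 (by positivity), ← Real.sqrt_mul (by positivity)]
    have h1 : 2 / Real.pi * ((k + 1 : ℕ) : ℝ) / (2 * L / (k + 2 : ℕ)) * (Real.pi * L)
        = (k + 1) * (k + 2) := by
      have := Real.pi_pos
      push_cast
      field_simp
    rw [h1]
    have h2 : (k : ℝ) + 2 ≤ (1 + δ) * k := by
      rw [div_le_iff₀ hδ] at hLδ
      nlinarith
    refine le_trans ?_ h2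
    rw [Real.sqrt_le_left (by positivity)]
    nlinarith
  calc _ ≤ (1 + δ) / √(Real.pi * L) * Real.exp (-L) := by gcongr
    _ = _ := by ring

lemma stdGaussian_inner_col_le {k : ℕ} {L δ : ℝ} (hL2 : 2 ≤ L) (hLδ : 2 / δ ≤ L) (hδ : 0 < δ)
    (hLk : L < k) {x : EuclideanSpace ℝ (Fin (k + 2))} (hx : ‖x‖ ^ 2 = (k + 2 : ℕ)) :
    stdGaussian (EuclideanSpace ℝ (Fin (k + 2)))
        {g | √(2 * L / (k + 2 : ℕ)) * (‖x‖ * ‖g‖) < |inner ℝ x g|}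
      ≤ ENNReal.ofReal ((1 + δ) * Real.exp (-L) / √(Real.pi * L)) := by
  have hx0 : 0 < ‖x‖ := by
    refine (norm_nonneg x).lt_of_ne fun h => ?_
    rw [← h] at hx
    push_cast at hx
    have : (0 : ℝ) ≤ k := Nat.cast_nonneg k
    norm_num at hx
    linarith
  rcases lt_or_ge (2 * L / (k + 2 : ℕ)) 1 with ha | ha
  · have hk : 0 < k := by
      have : (0 : ℝ) < k := by linarith
      exact_mod_cast this
    have hL0 : 0 < L := by linarith
    have hu : ‖(‖x‖⁻¹) • x‖ = 1 := by
      rw [norm_smul, norm_inv, norm_norm, inv_mul_cancel₀ hx0.ne']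
    have h1 := stdGaussian_cone_le hk hu (a := √(2 * L / (k + 2 : ℕ)))
      (Real.sqrt_pos.2 (by positivity)) (by rwa [Real.sqrt_lt' one_pos, one_pow])
    refine (measure_mono fun g hg => ?_).trans
      (h1.trans (ENNReal.ofReal_le_ofReal (cap_numeric hL2 hLδ hδ hLk ha)))
    simp only [Set.mem_ofPred_eq] at hg ⊢
    rw [real_inner_smul_left, abs_mul, abs_of_pos (inv_pos.2 hx0), inv_mul_eq_div,
      lt_div_iff₀ hx0]
    linarith
  -- When the cosine threshold is at least 1, the cone is empty by Cauchy–Schwarz.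
  · have : {g | √(2 * L / (k + 2 : ℕ)) * (‖x‖ * ‖g‖) < |inner ℝ x g|} = ∅ := by
      refine Set.eq_empty_of_forall_notMem fun g hg => ?_
      simp only [Set.mem_ofPred_eq] at hg
      have h1 := abs_real_inner_le_norm x g
      have h2 : 1 * (‖x‖ * ‖g‖) ≤ √(2 * L / (k + 2 : ℕ)) * (‖x‖ * ‖g‖) := by
        gcongr
        rwa [Real.one_le_sqrt]
      linarith
    rw [this, measure_empty]
    exact zero_le

/-- z* is a ratio homogeneous of degree zero in the noise, so σ cancels; since ‖x_j‖ = √n it is the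
maximal absolute cosine. -/
lemma zStar_le_of_abs_inner_col_le {X : Matrix (Fin n) (Fin p) ℝ} {bs : EuclideanSpace ℝ (Fin p)}
    {sigma a : ℝ} (hsigma : 0 < sigma) (ha : 0 ≤ a) (hn : 0 < n)
    (hcol : ∀ j, ‖col X j‖ ^ 2 = n) {g : EuclideanSpace ℝ (Fin n)}
    (hg : ∀ j, |inner ℝ (col X j) g| ≤ a * (‖col X j‖ * ‖g‖)) :
    zStar X (fit X bs + sigma • g) bs ≤ a := by
  have hn' : (0 : ℝ) < n := by exact_mod_cast hn
  have hsn : 0 < √(n : ℝ) := Real.sqrt_pos.2 hn'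
  rw [zStar, residualLevel, add_sub_cancel_left, norm_smul, Real.norm_of_nonneg hsigma.le]
  refine div_le_of_le_mul₀ (by positivity) ha (Real.iSup_le (fun j => ?_) (by positivity))
  have h1 : ‖col X j‖ = √(n : ℝ) := by
    rw [← hcol j, Real.sqrt_sq (norm_nonneg _)]
  have h2 := hg j
  rw [h1] at h2
  rw [real_inner_smul_right, abs_div, abs_mul, abs_of_pos hsigma, abs_of_pos hn',
    div_le_iff₀ hn']
  have h3 : a * (sigma * ‖g‖ / √(n : ℝ)) * n = sigma * (a * (√(n : ℝ) * ‖g‖)) := by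
    have := Real.mul_self_sqrt hn'.le
    field_simp
    rw [sq, this]
  rw [h3]
  gcongr

theorem one_sub_le_pr_zStar {δ : ℝ} (hδ : 0 < δ) (n p : ℕ) (X : Matrix (Fin n) (Fin p) ℝ)
    (bs : EuclideanSpace ℝ (Fin p)) (lam0 xi sigma eps : ℝ) (hxi : 1 < xi) (hsigma : 0 < sigma)
    (heps : 0 < eps) (hcol : ∀ j, ‖col X j‖ ^ 2 = n) (hL : max 2 (2 / δ) ≤ Real.log (p / eps))
    (hLn : Real.log (p / eps) < (n : ℝ) - 2) :
    1 - ENNReal.ofReal ((1 + δ) * eps / √(Real.pi * Real.log (p / eps)))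
        ≤ pr X bs sigma
          {y | tauStar X y bs lam0 xi ^ 2 < 1 →
            √(2 / n * Real.log (p / eps)) * (xi + 1)
                / ((xi - 1) * (1 - tauStar X y bs lam0 xi ^ 2)) ≤ lam0 →
            zStar X y bs
              ≤ (1 - tauStar X y bs lam0 xi ^ 2) * lam0 * (xi - 1) / (xi + 1)} := by
  set L := Real.log (p / eps) with hLdef
  have hL2 : 2 ≤ L := (le_max_left _ _).trans hL
  have hLδ : 2 / δ ≤ L := (le_max_right _ _).trans hL
  -- For p = 0 the convention log 0 = 0 contradicts L ≥ 2.
  have hp : 0 < p := by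
    rcases Nat.eq_zero_or_pos p with rfl | hp
    · simp at hLdef
      linarith
    · exact hp
  have hp' : (0 : ℝ) < p := by exact_mod_cast hp
  obtain ⟨k, rfl⟩ : ∃ k, n = k + 2 := ⟨n - 2, by
    have : (2 : ℝ) ≤ n := by linarith
    have : 2 ≤ n := by exact_mod_cast this
    omega⟩
  have hLk : L < k := by
    push_cast at hLn
    linarith
  set a := √(2 * L / (k + 2 : ℕ)) with ha
  have ha' : √(2 / (k + 2 : ℕ) * L) = a := by
    rw [ha]
    congr 1
    ring
  rw [pr_apply X bs hsigma.ne', tsub_le_iff_right, ha']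
  -- Subadditivity alone suffices here, so the event need not be measurable.
  refine le_trans (le_of_eq measure_univ.symm) ((measure_univ_le_add_compl _).trans
    (add_le_add_right ?_ _))
  have hsub : {g | fit X bs + sigma • g ∈ {y | tauStar X y bs lam0 xi ^ 2 < 1 →
            a * (xi + 1)
                / ((xi - 1) * (1 - tauStar X y bs lam0 xi ^ 2)) ≤ lam0 →
            zStar X y bs
              ≤ (1 - tauStar X y bs lam0 xi ^ 2) * lam0 * (xi - 1) / (xi + 1)}}ᶜ
      ⊆ ⋃ j, {g | a * (‖col X j‖ * ‖g‖) < |inner ℝ (col X j) g|} := by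
    intro g hg
    by_contra hcon
    simp only [Set.mem_iUnion, Set.mem_ofPred_eq, not_exists, not_lt] at hcon
    refine hg ?_
    simp only [Set.mem_ofPred_eq]
    intro htau hlam
    refine (zStar_le_of_abs_inner_col_le hsigma (Real.sqrt_nonneg _) (by omega) hcol hcon).trans ?_
    have h1 : 0 < 1 - tauStar X (fit X bs + sigma • g) bs lam0 xi ^ 2 := by linarith
    have h2 : 0 < xi - 1 := by linarith
    rw [div_le_iff₀ (by positivity)] at hlam
    rw [le_div_iff₀ (by linarith)]
    linarith
  calc _ ≤ _ := measure_mono hsub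
    _ ≤ ∑ j, stdGaussian (EuclideanSpace ℝ (Fin (k + 2)))
        {g | a * (‖col X j‖ * ‖g‖) < |inner ℝ (col X j) g|} := measure_iUnion_fintype_le _ _
    _ ≤ ∑ _j : Fin p, ENNReal.ofReal ((1 + δ) * Real.exp (-L) / √(Real.pi * L)) :=
        Finset.sum_le_sum fun j _ => stdGaussian_inner_col_le hL2 hLδ hδ hLk (hcol j)
    _ = ENNReal.ofReal (p * ((1 + δ) * Real.exp (-L) / √(Real.pi * L))) := by
        rw [Finset.sum_const, Finset.card_univ, Fintype.card_fin, nsmul_eq_mul,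
          ENNReal.ofReal_mul hp'.le, ENNReal.ofReal_natCast]
    _ = _ := by
        congr 1
        rw [Real.exp_neg, hLdef, Real.exp_log (by positivity)]
        field_simp

end ScaledLasso

theorem theorem3 :
    -- Deterministic part: false positives, refit noise estimate, prediction and estimation.
    (∀ (n p : ℕ) (X : Matrix (Fin n) (Fin p) ℝ) (y : EuclideanSpace ℝ (Fin n))
        (bs : EuclideanSpace ℝ (Fin p)) (lam0 xi : ℝ)
        (bhat : EuclideanSpace ℝ (Fin p)) (shat : ℝ)
        (bbar : EuclideanSpace ℝ (Fin p)) (m : ℕ),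
      0 < lam0 → 1 < xi →
      0 < residualLevel X y bs →
      IsScaledLasso X y lam0 bhat shat →
      IsRefit X y bhat bbar →
      ((supp bs).card : ℝ≥0∞) * ENNReal.ofReal (xi ^ 2) / kappa X xi (supp bs) ^ 2
        < (m : ℝ≥0∞) / kappaPlus X m (supp bs) →
      zStar X y bs ≤ (1 - tauStar X y bs lam0 xi ^ 2) * lam0 * (xi - 1) / (xi + 1) →
      (supp bhat \ supp bs).card < m ∧
      shat ^ 2 - (sigmaStar X y bs (m - 1) + √(etaStar X bs (shat * lam0) xi)) ^ 2
        ≤ residualLevel X y bbar ^ 2 ∧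
      residualLevel X y bbar ^ 2 ≤ shat ^ 2 ∧
      (1 - tauStar X y bs lam0 xi ^ 2) * (shat * lam0) ≤ residualLevel X y bs * lam0 ∧
      kappaMinus X (m - 1) (supp bs) * ENNReal.ofReal (‖bbar - bs‖ ^ 2)
        ≤ ENNReal.ofReal (‖fit X bbar - fit X bs‖ ^ 2 / n) ∧
      ‖fit X bbar - fit X bs‖ ^ 2 / n
        ≤ (sigmaStar X y bs (m - 1) + 2 * √(etaStar X bs (shat * lam0) xi)) ^ 2) ∧
    -- Gaussian tail bound for the projected noise.
    (∀ (n p : ℕ) (X : Matrix (Fin n) (Fin p) ℝ) (bs : EuclideanSpace ℝ (Fin p))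
        (sigma eps : ℝ) (m : ℕ),
      0 < sigma → 0 < eps → 1 ≤ m → m ≤ p →
      pr X bs sigma
          {y | √((m : ℝ) + (supp bs).card)
              + √(2 * m * Real.log (Real.exp 1 * p / m) + 2 * Real.log (1 / eps))
            ≤ sigmaStar X y bs m * √(n : ℝ) / sigma}
        ≤ ENNReal.ofReal (eps / m / √(2 * Real.pi))) ∧
    -- Probability of the event; `1 + δ` is `1 + o(1)` as `n - 2 > log (p / ε) → ∞`.
    (∀ δ : ℝ, 0 < δ → ∃ L : ℝ,
      ∀ (n p : ℕ) (X : Matrix (Fin n) (Fin p) ℝ) (bs : EuclideanSpace ℝ (Fin p))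
        (lam0 xi sigma eps : ℝ),
      0 < lam0 → 1 < xi → 0 < sigma → 0 < eps →
      (∀ j, ‖col X j‖ ^ 2 = n) →
      L ≤ Real.log (p / eps) → Real.log (p / eps) < (n : ℝ) - 2 →
      1 - ENNReal.ofReal ((1 + δ) * eps / √(Real.pi * Real.log (p / eps)))
        ≤ pr X bs sigma
          {y | tauStar X y bs lam0 xi ^ 2 < 1 →
            √(2 / n * Real.log (p / eps)) * (xi + 1)
                / ((xi - 1) * (1 - tauStar X y bs lam0 xi ^ 2)) ≤ lam0 →
            zStar X y bs
              ≤ (1 - tauStar X y bs lam0 xi ^ 2) * lam0 * (xi - 1) / (xi + 1)}) := by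
  -- The threshold 2 serves the exponential factor of the cap bound, and 2/δ serves its prefactor;
  -- neither depends on the other quantities.
  refine ⟨fun n p => deterministic_bounds, fun n p => pr_sigmaStar_le, fun δ hδ =>
    ⟨max 2 (2 / δ), ?_⟩⟩
  intro n p X bs lam0 xi sigma eps _ hxi hsigma heps hcol hL hLn
  exact one_sub_le_pr_zStar hδ n p X bs lam0 xi sigma eps hxi hsigma heps hcol hL hLn
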